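/- Let $K$ be an infinite field, let $\Gamma$ be a finite quiver, and let $\Lambda=K\Gamma/I$ be a monomial relation algebra, i.e. $I\subseteq K\Gamma$ is an ideal generated by paths which contains all sufficiently long paths and consists of linear combinations of paths of length at least $2$. Write $qp$ for "$q$ after $p$", identify the vertices of $\Gamma$ with the paths of length $0$, and let $J$ be the Jacobson radical of $\Lambda$. *Terminology.* A left module is uniserial if it is nonzero, finitely generated, and its submodules form a chain. A path $u$ is a right subpath of a path $p$ if $p=u'u$ for some path $u'$. A path $p$ of length $l$ is a *mast* of a uniserial left $\Lambda$-module $U$ if $U$ has composition length $l+1$ and $pU\neq 0$. A *top element* of $U$ is an element $x\in U\setminus JU$ with $x=ex$ for some vertex $e$. A *detour* on a path $p$ is a pair $(\alpha,u)$, where $u$ is a right subpath of $p$ and $\alpha$ is an arrow starting at the end vertex of $u$ such that $\alpha u$ is not a right subpath of $p$, but some right subpath of $p$ strictly longer than $u$ ends in the same vertex as $\alpha$; the right subpaths of the latter kind are denoted $v_i(\alpha,u)$, $i\in I(\alpha,u)$. Let $V_p$ be the set of all points $(k_i(\alpha,u))$, with entries in $K$ and indexed by the detours $(\alpha,u)$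 on $p$ and the $i\in I(\alpha,u)$, such that there are a uniserial left $\Lambda$-module $U$ with mast $p$ and a top element $x$ of $U$ with $\alpha u x=\sum_{i} k_i(\alpha,u)\,v_i(\alpha,u)x$ for all detours $(\alpha,u)$ on $p$. Let $A_p$ be the coordinate ring of $V_p$, that is, the polynomial ring $K[X_i(\alpha,u)]$ modulo the ideal of polynomials vanishing on $V_p$. A detour is a *halyard* on $p$ if one of its variables $X_i(\alpha,u)$ has nonzero image in $A_p$; a variable $X_i(\alpha,u)$ is *slack* if its image in $A_p$ is transcendental over $K$, and a halyard is slack if it has a slack variable. * $(\mathbf{Suf},p)$: for every slack halyard $(\alpha,u)$ on $p$ and every slack variable $X_r(\alpha,u)$ there is a right subpath $w$ of $p$, from the starting vertex of $p$ to itself, with $v_r(\alpha,u)=\alpha u w$ in $K\Gamma$. * Condition (N): whenever $\alpha:e\to e'$ is an arrow and $p:e\to e'$ is a mast, of positive length, of a uniserial left $\Lambda$-module, then $p=c'\alpha$ for an oriented cycle $c'$ at $e'$ or $p=\alpha c$ for an oriented cycle $c$ at $e$ (the cycles may be trivial). **Theorem.** The following statements are equivalent: 1. $\Lambda$ has finite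 uniserial type, i.e. there are only finitely many uniserial left $\Lambda$-modules up to isomorphism. 2. For each sequence $\mathbb S=(S(0),\dots,S(l))$ of simple left $\Lambda$-modules there is, up to isomorphism, at most one uniserial left $\Lambda$-module with consecutive composition factors $S(0),\dots,S(l)$ (from the top down). 3. Each mast $p$ of positive length of a uniserial left $\Lambda$-module satisfies $(\mathbf{Suf},p)$. 4. Condition (N) holds, and for each path $p\in K\Gamma\setminus I$, passing consecutively through the vertices $(e(0),\dots,e(l))$, the following is true: if $i<j<l$, $e(i)=e(j)$ and $e(i+1)\neq e(j+1)$, and if $K\Gamma\setminus I$ contains a path through $(e(0),\dots,e(i),e(j+1))$, then $(e(0),\dots,e(i))$ is a right segment of $(e(0),\dots,e(j))$, i.e. $e(k)=e(j-i+k)$ for $0\le k\le i$. Moreover, these statements are left-right symmetric: they are also equivalent to each of the corresponding statements for right $\Lambda$-modules, i.e. to (1) and (2) for the opposite algebra $\Lambda^{\mathrm{op}}$, and to (3) and (4) for $\Lambda^{\mathrm{op}}=K\Gamma^{\mathrm{op}}/I^{\mathrm{op}}$, where $\Gamma^{\mathrm{op}}$ is the opposite quiver and $I^{\mathrm{op}}$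 is obtained from $I$ by reversing all paths. -/

import Mathlib

universe u v w

open Quiver

noncomputable section

namespace UniserialType

/-! ### The path algebra of a quiver -/

/-- The type of all paths of a quiver `Γ` with vertex set `V` (paths of length zero are the
vertices).  A term is `⟨a, b, p⟩` with `p` a path from `a` to `b`. -/
abbrev AnyPath (V : Type v) [Quiver.{w} V] := Σ a b : V, Path a b

/-- The underlying `K`-vector space of the path algebra `KΓ`: it has the paths as a basis. -/
def PathAlgebra (K : Type u) (V : Type v) [Field K] [Quiver.{w} V] := AnyPath V →₀ K

namespace PathAlgebra

variable {K : Type u} {V : Type v} [Field K] [Quiver.{w} V]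

instance : AddCommGroup (PathAlgebra K V) := inferInstanceAs (AddCommGroup (AnyPath V →₀ K))
instance : Module K (PathAlgebra K V) := inferInstanceAs (Module K (AnyPath V →₀ K))

/-- The basis of the path algebra that consists of the paths. -/
def pathBasis : Module.Basis (AnyPath V) K (PathAlgebra K V) :=
  Module.Basis.ofRepr (LinearEquiv.refl K (AnyPath V →₀ K))

/-- The coefficient of a path in an element of the path algebra. -/
def coeff (x : PathAlgebra K V) (p : AnyPath V) : K := pathBasis.repr x p

/-- A path, given together with its end points, as an element of the path algebra. -/
def single (p : AnyPath V) : PathAlgebra K V := pathBasis p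

/-- A path as an element of the path algebra. -/
def ofPath {a b : V} (p : Path a b) : PathAlgebra K V := single ⟨a, b, p⟩

open Classical in
/-- The product `q p` (`q` after `p`) of two paths, which is zero unless `p` ends where `q`
starts. -/
def mulPath (q p : AnyPath V) : PathAlgebra K V :=
  if h : q.1 = p.2.1 then ofPath (p.2.2.comp (q.2.2.cast h rfl)) else 0

/-- The multiplication of the path algebra: the bilinear extension of `mulPath`. -/
def mulLin : PathAlgebra K V →ₗ[K] PathAlgebra K V →ₗ[K] PathAlgebra K V :=
  pathBasis.constr K fun q => pathBasis.constr K fun p => mulPath q p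

instance : Mul (PathAlgebra K V) := ⟨fun x y => mulLin x y⟩

instance [Finite V] : One (PathAlgebra K V) :=
  ⟨letI := Fintype.ofFinite V; ∑ a : V, ofPath (Path.nil : Path a a)⟩

theorem mul_def (x y : PathAlgebra K V) : x * y = mulLin x y := rfl

theorem mulLin_single (q p : AnyPath V) :
    mulLin (single q : PathAlgebra K V) (single p) = mulPath q p := by
  simp [mulLin, single]

theorem hom_ext {M : Type*} [AddCommGroup M] [Module K M] {f g : PathAlgebra K V →ₗ[K] M}
    (h : ∀ p, f (single p) = g (single p)) : f = g :=
  pathBasis.ext h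

theorem single_mul_single (q p : AnyPath V) :
    (single q * single p : PathAlgebra K V) = mulPath q p := mulLin_single q p

/-- The product of two composable paths is their composition. -/
theorem ofPath_mul_ofPath {a b c : V} (q : Path b c) (p : Path a b) :
    (ofPath q * ofPath p : PathAlgebra K V) = ofPath (p.comp q) := by
  simp [ofPath, single_mul_single, mulPath]

/-- The product of two paths that do not compose is zero. -/
theorem ofPath_mul_ofPath_of_ne {a b c d : V} (q : Path c d) (p : Path a b) (h : c ≠ b) :
    (ofPath q * ofPath p : PathAlgebra K V) = 0 := by
  simp [ofPath, single_mul_single, mulPath, h]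

theorem mul_assoc' (x y z : PathAlgebra K V) : x * y * z = x * (y * z) := by
  have key : (LinearMap.llcomp K (PathAlgebra K V) (PathAlgebra K V)
        (PathAlgebra K V →ₗ[K] PathAlgebra K V) mulLin).comp mulLin =
      (LinearMap.lcomp K (PathAlgebra K V →ₗ[K] PathAlgebra K V) mulLin).comp
        ((LinearMap.llcomp K (PathAlgebra K V) (PathAlgebra K V) (PathAlgebra K V)).comp
          mulLin) := by
    refine hom_ext fun r => hom_ext fun q => hom_ext fun p => ?_
    change single r * single q * single p = single r * (single q * single p)
    obtain ⟨c, d, r⟩ := r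
    obtain ⟨b, c', q⟩ := q
    obtain ⟨a, b', p⟩ := p
    change ofPath r * ofPath q * ofPath p = ofPath r * (ofPath q * ofPath p)
    have hz : ∀ t : PathAlgebra K V, 0 * t = 0 := fun t => by simp [mul_def]
    have hz' : ∀ t : PathAlgebra K V, t * 0 = 0 := fun t => by simp [mul_def]
    by_cases h : c = c'
    · subst h
      by_cases h' : b = b'
      · subst h'
        simp [ofPath_mul_ofPath]
      · simp [ofPath_mul_ofPath, ofPath_mul_ofPath_of_ne _ _ h', hz']
    · by_cases h' : b = b'
      · subst h'
        simp [ofPath_mul_ofPath, ofPath_mul_ofPath_of_ne _ _ h, hz]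
      · simp [ofPath_mul_ofPath_of_ne _ _ h', ofPath_mul_ofPath_of_ne _ _ h, hz, hz']
  exact congrArg (fun f => f x y z) key

theorem one_def [Fintype V] :
    (1 : PathAlgebra K V) = ∑ a : V, ofPath (Path.nil : Path a a) := by
  change (letI := Fintype.ofFinite V; ∑ a : V, ofPath (Path.nil : Path a a)) = _
  congr!

theorem one_mul' [Finite V] (x : PathAlgebra K V) : 1 * x = x := by
  have key : mulLin (1 : PathAlgebra K V) = LinearMap.id := by
    let _ := Fintype.ofFinite V
    refine hom_ext fun p => ?_
    obtain ⟨a, b, p⟩ := p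
    rw [one_def, map_sum, LinearMap.sum_apply]
    change ∑ c : V, ofPath (Path.nil : Path c c) * ofPath p = ofPath p
    rw [Finset.sum_eq_single b]
    · rw [ofPath_mul_ofPath]; rfl
    · intro c _ hc
      exact ofPath_mul_ofPath_of_ne _ _ hc
    · simp
  exact congrArg (fun f => f x) key

theorem mul_one' [Finite V] (x : PathAlgebra K V) : x * 1 = x := by
  have key : mulLin.flip (1 : PathAlgebra K V) = LinearMap.id := by
    let _ := Fintype.ofFinite V
    refine hom_ext fun p => ?_
    obtain ⟨a, b, p⟩ := p
    rw [one_def, map_sum, LinearMap.sum_apply]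
    change ∑ c : V, ofPath p * ofPath (Path.nil : Path c c) = ofPath p
    rw [Finset.sum_eq_single a]
    · rw [ofPath_mul_ofPath]; simp
    · intro c _ hc
      exact ofPath_mul_ofPath_of_ne _ _ (Ne.symm hc)
    · simp
  exact congrArg (fun f => f x) key

instance [Finite V] : Ring (PathAlgebra K V) :=
  { (inferInstance : AddCommGroup (PathAlgebra K V)) with
    mul := (· * ·)
    one := 1
    left_distrib := fun x y z => map_add (mulLin x) y z
    right_distrib := fun x y z => by simp [mul_def]
    zero_mul := fun x => by simp [mul_def]
    mul_zero := fun x => by simp [mul_def]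
    mul_assoc := mul_assoc'
    one_mul := one_mul'
    mul_one := mul_one' }

instance [Finite V] : Algebra K (PathAlgebra K V) :=
  Algebra.ofModule (fun k x y => by simp [mul_def]) (fun k x y => by simp [mul_def])

end PathAlgebra

/-! ### Ideals of the path algebra and bound quiver algebras -/

section Ideals

variable {K : Type u} {V : Type v} [Field K] [Quiver.{w} V] [Finite V]

/-- An ideal `I` of `KΓ` is admissible if it contains all sufficiently long paths and consists
of linear combinations of paths of length at least two. -/
def IsAdmissible (I : TwoSidedIdeal (PathAlgebra K V)) : Prop :=
  (∃ N : ℕ, ∀ (a b : V) (p : Path a b), N ≤ p.length → PathAlgebra.ofPath p ∈ I) ∧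
    ∀ x ∈ I, ∀ p : AnyPath V, x.coeff p ≠ 0 → 2 ≤ p.2.2.length

/-- An ideal of `KΓ` is monomial if it is generated, as a two-sided ideal, by a set of paths. -/
def IsMonomial (I : TwoSidedIdeal (PathAlgebra K V)) : Prop :=
  ∃ S : Set (AnyPath V), I = TwoSidedIdeal.span (PathAlgebra.single '' S)

/-- The algebra `Λ = KΓ / I`. -/
abbrev BoundAlgebra (I : TwoSidedIdeal (PathAlgebra K V)) := I.ringCon.Quotient

/-- The residue class of a path in `Λ = KΓ / I`. -/
def pathClass (I : TwoSidedIdeal (PathAlgebra K V)) {a b : V} (p : Path a b) :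
    BoundAlgebra I :=
  I.ringCon.mk' (PathAlgebra.ofPath p)

/-- `p ∈ KΓ ∖ I` for a path `p`. -/
def NonzeroPath (I : TwoSidedIdeal (PathAlgebra K V)) {a b : V} (p : Path a b) : Prop :=
  PathAlgebra.ofPath p ∉ I

end Ideals

/-! ### The opposite quiver and the opposite ideal -/

section Opposite

variable {K : Type u} {V : Type v} [Field K] [Quiver.{w} V]

open Opposite in
/-- A path of the opposite quiver, read backwards as a path of the quiver. -/
def unopPath {a : Vᵒᵖ} : {b : Vᵒᵖ} → Path a b → Path b.unop a.unop
  | _, Path.nil => Path.nil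
  | _, Path.cons p e => e.unop.toPath.comp (unopPath p)

theorem unopPath_comp {a b c : Vᵒᵖ} (p : Path a b) (q : Path b c) :
    unopPath (p.comp q) = (unopPath q).comp (unopPath p) := by
  induction q with
  | nil => simp [unopPath]
  | cons q e ih => simp [unopPath, ih]

/-- The linear map `KΓᵒᵖ → KΓ` that reads paths backwards. -/
def revLin : PathAlgebra K Vᵒᵖ →ₗ[K] PathAlgebra K V :=
  PathAlgebra.pathBasis.constr K fun p => PathAlgebra.ofPath (unopPath p.2.2)

theorem revLin_ofPath {a b : Vᵒᵖ} (p : Path a b) :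
    revLin (PathAlgebra.ofPath p : PathAlgebra K Vᵒᵖ) = PathAlgebra.ofPath (unopPath p) := by
  simp [revLin, PathAlgebra.ofPath, PathAlgebra.single]

theorem revLin_mul_ofPath {a b c d : Vᵒᵖ} (q : Path c d) (p : Path a b) :
    revLin (PathAlgebra.ofPath q * PathAlgebra.ofPath p : PathAlgebra K Vᵒᵖ) =
      PathAlgebra.ofPath (unopPath p) * PathAlgebra.ofPath (unopPath q) := by
  by_cases h : c = b
  · subst h
    rw [PathAlgebra.ofPath_mul_ofPath, PathAlgebra.ofPath_mul_ofPath, revLin_ofPath,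
      unopPath_comp]
  · rw [PathAlgebra.ofPath_mul_ofPath_of_ne _ _ h, PathAlgebra.ofPath_mul_ofPath_of_ne,
      map_zero]
    exact fun h' => h (Opposite.unop_injective h'.symm)

theorem revLin_mul (x y : PathAlgebra K Vᵒᵖ) : revLin (x * y) = revLin y * revLin x := by
  let f : PathAlgebra K Vᵒᵖ →ₗ[K] PathAlgebra K Vᵒᵖ →ₗ[K] PathAlgebra K V :=
    PathAlgebra.mulLin.compr₂ revLin
  let g : PathAlgebra K Vᵒᵖ →ₗ[K] PathAlgebra K Vᵒᵖ →ₗ[K] PathAlgebra K V :=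
    PathAlgebra.mulLin.flip.compl₁₂ revLin revLin
  have key : f = g := by
    refine PathAlgebra.hom_ext fun q => PathAlgebra.hom_ext fun p => ?_
    have h := revLin_mul_ofPath (K := K) q.2.2 p.2.2
    rw [← revLin_ofPath, ← revLin_ofPath] at h
    exact h
  exact congrArg (fun f => f x y) key

variable [Finite V]

instance finite_opposite : Finite Vᵒᵖ := Finite.of_equiv V Opposite.equivToOpposite

theorem revLin_one : revLin (1 : PathAlgebra K Vᵒᵖ) = 1 := by
  let _ := Fintype.ofFinite V
  let _ := Fintype.ofFinite Vᵒᵖ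
  rw [PathAlgebra.one_def, map_sum, PathAlgebra.one_def]
  simp only [revLin_ofPath]
  exact (Fintype.sum_equiv Opposite.equivToOpposite _ _ fun a => rfl).symm

/-- The ring homomorphism (in fact isomorphism) `KΓᵒᵖ → (KΓ)ᵒᵖ` that reads paths backwards. -/
def opHom : PathAlgebra K Vᵒᵖ →+* (PathAlgebra K V)ᵐᵒᵖ where
  toFun x := MulOpposite.op (revLin x)
  map_zero' := by simp
  map_add' x y := by simp
  map_one' := by simp [revLin_one]
  map_mul' x y := by simp [revLin_mul]

/-- The ideal `Iᵒᵖ` of `KΓᵒᵖ` that consists of the elements of `I` with all paths read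
backwards; thus `KΓᵒᵖ / Iᵒᵖ` is the opposite algebra of `KΓ / I`, and left modules over it are
right modules over `KΓ / I`. -/
def oppositeIdeal (I : TwoSidedIdeal (PathAlgebra K V)) : TwoSidedIdeal (PathAlgebra K Vᵒᵖ) :=
  TwoSidedIdeal.comap opHom I.op

theorem mem_oppositeIdeal {I : TwoSidedIdeal (PathAlgebra K V)} {x : PathAlgebra K Vᵒᵖ} :
    x ∈ oppositeIdeal I ↔ revLin x ∈ I := by
  rw [oppositeIdeal, TwoSidedIdeal.mem_comap, TwoSidedIdeal.mem_op_iff]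
  rfl

end Opposite

/-! ### Detours on a path -/

section Detours

variable {V : Type v} [Quiver.{w} V]

/-- `u` is a right subpath (an initial segment) of `p`: one has `p = u' u`, i.e. `u'` after `u`,
for some path `u'`. -/
def IsRightSubpath {a b c : V} (u : Path a c) (p : Path a b) : Prop :=
  ∃ u' : Path c b, p = u.comp u'

/-- A detour `(α, u)` on `p`: a right subpath `u` of `p` and an arrow `α` starting where `u` ends,
such that `α u` is not a right subpath of `p` but some right subpath of `p` that is strictly
longer than `u` ends in the same vertex as `α`. -/
structure Detour {a b : V} (p : Path a b) where
  c : V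
  d : V
  u : Path a c
  α : c ⟶ d
  right_subpath : IsRightSubpath u p
  not_right_subpath : ¬ IsRightSubpath (u.cons α) p
  exists_longer : ∃ v : Path a d, IsRightSubpath v p ∧ u.length < v.length

/-- The family `v_i(α, u)` of all right subpaths of `p` that are longer than `u` and end in the
same vertex as `α`, for a detour `(α, u)` on `p`. -/
abbrev Detour.Longer {a b : V} {p : Path a b} (D : Detour p) :=
  {v : Path a D.d // IsRightSubpath v p ∧ D.u.length < v.length}

theorem finite_rightSubpaths {a b : V} (p : Path a b) (d : V) :
    {v : Path a d | IsRightSubpath v p}.Finite := by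
  induction p with
  | nil =>
    refine Set.Subsingleton.finite ?_
    rintro v ⟨v', hv⟩ w ⟨w', hw⟩
    have h1 := congrArg Path.length hv
    have h2 := congrArg Path.length hw
    simp only [Path.length_nil, Path.length_comp] at h1 h2
    obtain rfl : a = d := Path.eq_of_length_zero v (by omega)
    rw [Path.eq_nil_of_length_zero v (by omega), Path.eq_nil_of_length_zero w (by omega)]
  | @cons b c p e ih =>
    refine (ih.union (Set.Subsingleton.finite
      (s := {v : Path a d | ∃ h : d = c, v = h ▸ p.cons e}) ?_)).subset ?_
    · rintro v ⟨h, hv⟩ w ⟨h', hw⟩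
      rw [hv, hw]
    · rintro v ⟨v', hv⟩
      cases v' with
      | nil => exact Or.inr ⟨rfl, hv.symm⟩
      | cons v'' f =>
        simp only [Path.comp_cons] at hv
        obtain rfl := Path.obj_eq_of_cons_eq_cons hv
        exact Or.inl ⟨v'', eq_of_heq (Path.heq_of_cons_eq_cons hv)⟩

instance {a b : V} {p : Path a b} (D : Detour p) : Finite D.Longer :=
  ((finite_rightSubpaths p D.d).subset fun _ h => h.1 :
    {v : Path a D.d | IsRightSubpath v p ∧ D.u.length < v.length}.Finite)

/-- The triples `(α, u, i)` with `(α, u)` a detour on `p` and `v_i(α, u)` a member of its family;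
they index the variables `X_i(α, u)`. -/
abbrev Variable {a b : V} (p : Path a b) := Σ D : Detour p, D.Longer

end Detours

/-! ### Uniserial modules -/

section Uniserial

/-- A uniserial left module: a nonzero finitely generated module whose submodules form a
chain. -/
def IsUniserial (R : Type u) [Ring R] (M : Type v) [AddCommGroup M] [Module R M] : Prop :=
  Nontrivial M ∧ Module.Finite R M ∧ ∀ N N' : Submodule R M, N ≤ N' ∨ N' ≤ N

/-- `R` has finite uniserial type: finitely many modules represent all isomorphism classes of
uniserial left `R`-modules. -/
def FiniteUniserialType (R : Type u) [Ring R] : Prop :=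
  ∃ (n : ℕ) (U : Fin n → ModuleCat.{u} R),
    ∀ M : ModuleCat.{u} R, IsUniserial R M → ∃ i, Nonempty (M ≃ₗ[R] U i)

/-- `M` has the sequence `S(0), …, S(l)` of consecutive composition factors, from the top down:
there is a chain `M = F 0 ⊇ F 1 ⊇ ⋯ ⊇ F (l+1) = 0` of submodules with
`F i / F (i+1) ≅ S(i)`. -/
def HasCompositionSeries (R : Type u) [Ring R] (M : ModuleCat.{u} R) {l : ℕ}
    (S : Fin (l + 1) → ModuleCat.{u} R) : Prop :=
  ∃ F : Fin (l + 2) → Submodule R M, F 0 = ⊤ ∧ F (Fin.last (l + 1)) = ⊥ ∧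
    ∀ i : Fin (l + 1), F i.succ ≤ F i.castSucc ∧
      Nonempty ((F i.castSucc ⧸ (F i.succ).submoduleOf (F i.castSucc)) ≃ₗ[R] S i)

/-- For each sequence of simple left `R`-modules there is, up to isomorphism, at most one
uniserial left `R`-module which has that sequence of consecutive composition factors. -/
def AtMostOneUniserialPerSeries (R : Type u) [Ring R] : Prop :=
  ∀ (l : ℕ) (S : Fin (l + 1) → ModuleCat.{u} R), (∀ i, IsSimpleModule R (S i)) →
    ∀ M N : ModuleCat.{u} R, IsUniserial R M → IsUniserial R N →
      HasCompositionSeries R M S → HasCompositionSeries R N S → Nonempty (M ≃ₗ[R] N)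

end Uniserial

/-! ### Masts, the varieties `V_p`, and slack variables -/

section Masts

variable {K : Type u} {V : Type v} [Field K] [Quiver.{w} V] [Finite V]

/-- The path `p` of length `l` is a mast of the left `Λ`-module `U`: the module `U` is
uniserial of composition length `l + 1`, and `p U ≠ 0`. -/
def IsMastOf (I : TwoSidedIdeal (PathAlgebra K V)) {a b : V} (p : Path a b)
    (U : Type (max u v w)) [AddCommGroup U] [Module (BoundAlgebra I) U] : Prop :=
  IsUniserial (BoundAlgebra I) U ∧ Module.length (BoundAlgebra I) U = p.length + 1 ∧
    ∃ x : U, pathClass I p • x ≠ 0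

/-- The path `p` is a mast of some uniserial left `Λ`-module. -/
def IsMast (I : TwoSidedIdeal (PathAlgebra K V)) {a b : V} (p : Path a b) : Prop :=
  ∃ U : ModuleCat.{max u v w} (BoundAlgebra I), IsMastOf I p U

/-- A top element of `U`: an element `x` of `U` outside `J U` with `x = e x` for some
vertex `e`; here `J` is the Jacobson radical of `Λ`. -/
def IsTopElement (I : TwoSidedIdeal (PathAlgebra K V)) {U : Type (max u v w)} [AddCommGroup U]
    [Module (BoundAlgebra I) U] (x : U) : Prop :=
  x ∉ Ring.jacobson (BoundAlgebra I) • (⊤ : Submodule (BoundAlgebra I) U) ∧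
    ∃ e : V, x = pathClass I (Path.nil : Path e e) • x

/-- The variety `V_p` in the affine space with one coordinate for each variable `X_i(α, u)`:
a point `k` belongs to `V_p` if there are a uniserial module `U` with mast `p` and a top element
`x` of `U` such that `α u x = ∑ i, k_i(α, u) v_i(α, u) x` for every detour `(α, u)` on `p`. -/
def uniserialVariety (I : TwoSidedIdeal (PathAlgebra K V)) {a b : V} (p : Path a b) :
    Set (Variable p → K) :=
  {k | ∃ U : ModuleCat.{max u v w} (BoundAlgebra I), IsMastOf I p U ∧
    ∃ x : U, IsTopElement I x ∧ ∀ D : Detour p,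
      pathClass I (D.u.cons D.α) • x =
        (∑ᶠ i : D.Longer, k ⟨D, i⟩ • pathClass I i.1) • x}

/-- The coordinate ring `A_p` of `V_p`. -/
abbrev coordinateRing (I : TwoSidedIdeal (PathAlgebra K V)) {a b : V} (p : Path a b) :=
  MvPolynomial (Variable p) K ⧸ MvPolynomial.vanishingIdeal K (uniserialVariety I p)

/-- The image of the variable `X_i(α, u)` in `A_p`. -/
def variableImage (I : TwoSidedIdeal (PathAlgebra K V)) {a b : V} {p : Path a b}
    (t : Variable p) : coordinateRing I p :=
  Ideal.Quotient.mk _ (MvPolynomial.X t)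

/-- The detour `(α, u)` is a halyard on `p` if at least one of its variables has nonzero image
in `A_p`. -/
def IsHalyard (I : TwoSidedIdeal (PathAlgebra K V)) {a b : V} {p : Path a b} (D : Detour p) :
    Prop :=
  ∃ i : D.Longer, variableImage I ⟨D, i⟩ ≠ 0

/-- `X_i(α, u)` is a slack variable of the halyard `(α, u)`: its image in `A_p` is
transcendental over `K`.  A halyard is slack if it has a slack variable. -/
def IsSlackVariable (I : TwoSidedIdeal (PathAlgebra K V)) {a b : V} {p : Path a b}
    (D : Detour p) (i : D.Longer) : Prop :=
  IsHalyard I D ∧ Transcendental K (variableImage I ⟨D, i⟩)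

/-- Condition `(Suf, p)`: for every slack variable `X_i(α, u)` of a slack halyard `(α, u)` on
`p` there is a right subpath `w` of `p` from the starting vertex of `p` to itself with
`v_i(α, u) = α u w`. -/
def Suf (I : TwoSidedIdeal (PathAlgebra K V)) {a b : V} (p : Path a b) : Prop :=
  ∀ (D : Detour p) (i : D.Longer), IsSlackVariable I D i →
    ∃ w : Path a a, IsRightSubpath w p ∧ i.1 = (w.comp D.u).cons D.α

/-- Every mast of positive length of a uniserial left `Λ`-module satisfies `(Suf, p)`. -/
def AllMastsSuf (I : TwoSidedIdeal (PathAlgebra K V)) : Prop :=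
  ∀ (a b : V) (p : Path a b), 0 < p.length → IsMast I p → Suf I p

/-- Condition (N): if `α : e ⟶ e'` is an arrow and `p : e → e'` is a mast of positive length, then
`p = c' α` for an oriented cycle `c'` at `e'`, or `p = α c` for an oriented cycle `c` at `e`
(the cycles may be trivial). -/
def ConditionN (I : TwoSidedIdeal (PathAlgebra K V)) : Prop :=
  ∀ (e e' : V) (α : e ⟶ e') (p : Path e e'), 0 < p.length → IsMast I p →
    (∃ c' : Path e' e', p = α.toPath.comp c') ∨ ∃ c : Path e e, p = c.cons α

/-- The sequence `(e(0), …, e(n))`, as a list. -/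
def vertexSeq (e : ℕ → V) (n : ℕ) : List V := (List.range (n + 1)).map e

/-- The repeated segment condition: for every path `p ∈ KΓ ∖ I` through `(e(0), …, e(l))` and all
`i < j < l` with `e(i) = e(j)` and `e(i+1) ≠ e(j+1)`, if `KΓ ∖ I` contains a path through
`(e(0), …, e(i), e(j+1))`, then `(e(0), …, e(i))` is a right segment of `(e(0), …, e(j))`, that is,
a suffix of it. -/
def RepeatedSegments (I : TwoSidedIdeal (PathAlgebra K V)) : Prop :=
  ∀ (l : ℕ) (e : ℕ → V) (a b : V) (p : Path a b),
    p.vertices = vertexSeq e l → NonzeroPath I p →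
    ∀ i j : ℕ, i < j → j < l → e i = e j → e (i + 1) ≠ e (j + 1) →
      (∃ (a' b' : V) (q : Path a' b'),
        q.vertices = vertexSeq e i ++ [e (j + 1)] ∧ NonzeroPath I q) →
      vertexSeq e i <:+ vertexSeq e j

end Masts

end UniserialType

end

noncomputable section

namespace UniserialType

/-! All eight statements are equivalent to one combinatorial condition, `SufCondition`: if `p` and
`αu` are nonzero paths with the same end points, `u` is a proper initial segment of `p`, and `αu` is
not an initial segment of `p`, then `p = αuw` for a cycle `w`.

Suppose it fails for `p`, `u`, `α`. The functional "coefficient of `p` plus `κ` times coefficient of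
`αu`" vanishes on the monomial ideal `I`. It defines a cyclic module which is uniserial with mast
`p` and on whose generator `αu` acts as `κp` (`isAdapted_familyGenerator`). As `p` does not end in
`αu`, no change of top element can alter `κ` (`familyModule_injective`), so an infinite field gives
infinitely many uniserial modules. The same family puts a coordinate line into `V_p` and thereby
makes the corresponding variable slack (`sufCondition_of_allMastsSuf`).

Conversely, assume the condition and let `x` be a top element of a uniserial module with mast `p`.
The layers of the radical filtration are lines spanned by the classes of `vx`, with `v` an initial
segment of `p`. If `αu` leaves `p` and `αux` is nonzero, its leading term is some `k vx`; the
condition gives `v = αuw`, and replacing `x` by `x - k wx` removes this term. Iteration leads to a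
top element killed by all paths other than the initial segments of `p`
(`SufCondition.exists_isStandard`), so the mast determines the module. For trivial `u` the condition
rules out parallel arrows; hence the composition factors determine the vertices of the mast, thus
the mast, thus the module. Uniqueness yields finite type, because there are finitely many nonzero
paths and modules with the same mast have the same composition factors.

Statement (4) is the condition read off from vertex sequences. The symmetry is pure path
combinatorics: `SufCondition` implies its mirror image `CosufCondition`, which is `SufCondition` for
the opposite quiver. -/

theorem vertexSeq_take {V : Type v} (e : ℕ → V) {n l : ℕ} (h : n ≤ l) :
    (vertexSeq e l).take (n + 1) = vertexSeq e n := by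
  simp [vertexSeq, ← List.map_take, List.take_range, h]

theorem vertexSeq_succ {V : Type v} (e : ℕ → V) (n : ℕ) :
    vertexSeq e (n + 1) = vertexSeq e n ++ [e (n + 1)] := by
  simp [vertexSeq, List.range_succ]

/-! ### Initial segments of paths -/

section Prefixes

variable {V : Type v} [Quiver.{w} V]

/-- The last arrows of the two factorizations agree and can be cancelled until `s` is used up. This
makes the initial segments of a path a chain ordered by length. -/
theorem exists_of_comp_eq_comp {a b c d : V} (u : Path a b) (r : Path b d) (v : Path a c)
    (s : Path c d) (h : u.comp r = v.comp s) (hl : u.length ≤ v.length) :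
    ∃ t : Path b c, v = u.comp t ∧ r = t.comp s := by
  induction s generalizing b with
  | nil => exact ⟨r, by simpa using h.symm, by simp⟩
  | @cons d' d'' s e ih =>
    cases r with
    | nil =>
      have := congrArg Path.length h
      simp only [Path.comp_nil, Path.length_comp, Path.length_cons] at this
      omega
    | cons r e' =>
      simp only [Path.comp_cons] at h
      obtain rfl := Path.obj_eq_of_cons_eq_cons h
      obtain ⟨t, h1, h2⟩ := ih u r (eq_of_heq (Path.heq_of_cons_eq_cons h)) hl
      refine ⟨t, h1, ?_⟩
      rw [h2, eq_of_heq (Path.hom_heq_of_cons_eq_cons h), Path.comp_cons]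

theorem cons_inj {a b c : V} {p q : Path a b} {e f : b ⟶ c} (h : p.cons e = q.cons f) :
    p = q ∧ e = f :=
  ⟨eq_of_heq (Path.heq_of_cons_eq_cons h), eq_of_heq (Path.hom_heq_of_cons_eq_cons h)⟩

theorem isRightSubpath_refl {a b : V} (p : Path a b) : IsRightSubpath p p := ⟨Path.nil, by simp⟩

theorem isRightSubpath_nil {a b : V} (p : Path a b) : IsRightSubpath Path.nil p := ⟨p, by simp⟩

theorem isRightSubpath_comp {a b c : V} (u : Path a b) (r : Path b c) :
    IsRightSubpath u (u.comp r) := ⟨r, rfl⟩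

theorem IsRightSubpath.trans {a b c d : V} {u : Path a b} {v : Path a c} {p : Path a d}
    (h : IsRightSubpath u v) (h' : IsRightSubpath v p) : IsRightSubpath u p := by
  obtain ⟨r, rfl⟩ := h
  obtain ⟨s, rfl⟩ := h'
  exact ⟨r.comp s, by simp⟩

theorem IsRightSubpath.length_le {a b c : V} {u : Path a b} {p : Path a c}
    (h : IsRightSubpath u p) : u.length ≤ p.length := by
  obtain ⟨r, rfl⟩ := h
  simp

theorem IsRightSubpath.of_length_le {a b c d : V} {u : Path a b} {v : Path a c} {p : Path a d}
    (hu : IsRightSubpath u p) (hv : IsRightSubpath v p) (hl : u.length ≤ v.length) :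
    IsRightSubpath u v := by
  obtain ⟨r, rfl⟩ := hu
  obtain ⟨s, hs⟩ := hv
  obtain ⟨t, ht, -⟩ := exists_of_comp_eq_comp _ _ _ _ hs hl
  exact ⟨t, ht⟩

theorem IsRightSubpath.end_eq {a b c : V} {u : Path a b} {p : Path a c}
    (h : IsRightSubpath u p) (hl : p.length ≤ u.length) : b = c := by
  obtain ⟨r, rfl⟩ := h
  exact Path.eq_of_length_zero r (by simp only [Path.length_comp] at hl; omega)

theorem IsRightSubpath.eq_of_length_le {a b : V} {u p : Path a b}
    (h : IsRightSubpath u p) (hl : p.length ≤ u.length) : u = p := by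
  obtain ⟨r, rfl⟩ := h
  rw [Path.eq_nil_of_length_zero r (by simp only [Path.length_comp] at hl; omega), Path.comp_nil]

theorem IsRightSubpath.comp_left {a b c d : V} {u : Path b c} {p : Path b d}
    (h : IsRightSubpath u p) (w : Path a b) : IsRightSubpath (w.comp u) (w.comp p) := by
  obtain ⟨r, rfl⟩ := h
  exact ⟨r, by simp⟩

theorem IsRightSubpath.of_comp_left {a b c d : V} {u : Path b c} {p : Path b d} {w : Path a b}
    (h : IsRightSubpath (w.comp u) (w.comp p)) : IsRightSubpath u p := by
  obtain ⟨r, hr⟩ := h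
  rw [Path.comp_assoc, Path.comp_inj_right] at hr
  exact ⟨r, hr⟩

theorem exists_isRightSubpath_length {a b : V} (p : Path a b) {n : ℕ} (hn : n ≤ p.length) :
    ∃ (c : V) (v : Path a c), IsRightSubpath v p ∧ v.length = n := by
  obtain ⟨c, v, r, h, h'⟩ := p.exists_eq_comp_of_le_length hn
  exact ⟨c, v, ⟨r, h⟩, h'⟩

/-- A path that is not an initial segment of `p` leaves `p` at a well-defined arrow. -/
theorem exists_break {a b c : V} (p : Path a b) (q : Path a c) (h : ¬ IsRightSubpath q p) :
    ∃ (d e : V) (s : Path a d) (β : d ⟶ e) (r : Path e c), q = (s.cons β).comp r ∧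
      IsRightSubpath s p ∧ ¬ IsRightSubpath (s.cons β) p := by
  induction q with
  | nil => exact absurd (isRightSubpath_nil p) h
  | cons q e ih =>
    by_cases hq : IsRightSubpath q p
    · exact ⟨_, _, q, e, Path.nil, by simp, hq, h⟩
    · obtain ⟨d, d', s, β, r, rfl, h1, h2⟩ := ih hq
      exact ⟨d, d', s, β, r.cons e, by simp, h1, h2⟩

/-- `u` is a terminal segment of `p`. -/
def IsLeftSubpath {a b c : V} (u : Path c b) (p : Path a b) : Prop :=
  ∃ t : Path a c, p = t.comp u

theorem vertices_prefix {a b c : V} {u : Path a c} {p : Path a b} (h : IsRightSubpath u p) :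
    p.vertices.take (u.length + 1) = u.vertices := by
  obtain ⟨r, rfl⟩ := h
  induction r with
  | nil => simp
  | cons r e ih =>
    rw [Path.comp_cons, Path.vertices_cons, List.concat_eq_append, List.take_append_of_le_length,
      ih]
    simp

theorem vertices_isRightSubpath {a b c : V} {u : Path a c} {p : Path a b} {e : ℕ → V} {l : ℕ}
    (h : IsRightSubpath u p) (hp : p.vertices = vertexSeq e l) :
    u.vertices = vertexSeq e u.length := by
  have hl := congrArg List.length hp
  simp only [Path.vertices_length, vertexSeq, List.length_map, List.length_range] at hl
  rw [← vertices_prefix h, hp, vertexSeq_take e (by have := h.length_le; omega)]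

theorem end_eq_of_vertices {a b : V} {p : Path a b} {e : ℕ → V} {l : ℕ}
    (hp : p.vertices = vertexSeq e l) : b = e l := by
  have h := p.vertices_getLast
  simp only [hp, vertexSeq, List.range_succ, List.map_append, List.map_cons, List.map_nil,
    List.getLast_append_singleton] at h
  exact h.symm

theorem start_eq_of_vertices {a b : V} {p : Path a b} {e : ℕ → V} {l : ℕ}
    (hp : p.vertices = vertexSeq e l) : a = e 0 := by
  have h := p.vertices_head?
  simp only [hp, vertexSeq, List.range_succ_eq_map, List.map_cons, List.head?_cons,
    Option.some.injEq] at h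
  exact h.symm

theorem vertices_eq_vertexSeq {a b : V} (p : Path a b) :
    p.vertices = vertexSeq (fun k => p.vertices.getD k a) p.length := by
  refine List.ext_getElem (by simp [vertexSeq]) fun n h1 h2 => ?_
  simp only [vertexSeq, List.getElem_map, List.getElem_range]
  exact (List.getD_eq_getElem _ _ h1).symm

theorem coeff_single_self {K : Type u} [Field K] (p : AnyPath V) :
    (PathAlgebra.single p : PathAlgebra K V).coeff p = 1 := by
  simp [PathAlgebra.coeff, PathAlgebra.single]

theorem coeff_single_of_ne {K : Type u} [Field K] {p q : AnyPath V} (h : q ≠ p) :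
    (PathAlgebra.single q : PathAlgebra K V).coeff p = 0 := by
  simp [PathAlgebra.coeff, PathAlgebra.single, h]

theorem isRightSubpath_of_mk_eq {a b c : V} {s : Path a c} {p : Path a b}
    (h : (⟨a, c, s⟩ : AnyPath V) = ⟨a, b, p⟩) : IsRightSubpath s p := by
  cases h
  exact isRightSubpath_refl _

theorem length_eq_of_mk_eq {a b c d : V} {s : Path a c} {p : Path b d}
    (h : (⟨a, c, s⟩ : AnyPath V) = ⟨b, d, p⟩) : s.length = p.length := by
  cases h
  rfl

theorem Detour.ext_of_mk_eq {a b : V} {p : Path a b} {D D' : Detour p}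
    (h : (⟨a, D.d, D.u.cons D.α⟩ : AnyPath V) = ⟨a, D'.d, D'.u.cons D'.α⟩) : D = D' := by
  obtain ⟨c, d, u, α, _, _, _⟩ := D
  obtain ⟨c', d', u', α', _, _, _⟩ := D'
  cases h
  rfl

end Prefixes

/-! ### The suffix conditions -/

section Conditions

variable {K : Type u} {V : Type v} [Field K] [Quiver.{w} V] [Finite V]

theorem NonzeroPath.left {I : TwoSidedIdeal (PathAlgebra K V)} {a b c : V} {p : Path a b}
    {q : Path b c} (h : NonzeroPath I (p.comp q)) : NonzeroPath I p := fun hp =>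
  h (by rw [← PathAlgebra.ofPath_mul_ofPath]; exact I.mul_mem_left _ _ hp)

theorem NonzeroPath.right {I : TwoSidedIdeal (PathAlgebra K V)} {a b c : V} {p : Path a b}
    {q : Path b c} (h : NonzeroPath I (p.comp q)) : NonzeroPath I q := fun hp =>
  h (by rw [← PathAlgebra.ofPath_mul_ofPath]; exact I.mul_mem_right _ _ hp)

theorem NonzeroPath.of_isRightSubpath {I : TwoSidedIdeal (PathAlgebra K V)} {a b c : V}
    {u : Path a c} {p : Path a b} (h : NonzeroPath I p) (hu : IsRightSubpath u p) :
    NonzeroPath I u := by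
  obtain ⟨r, rfl⟩ := hu
  exact h.left

theorem IsAdmissible.nonzeroPath {I : TwoSidedIdeal (PathAlgebra K V)} (h : IsAdmissible I)
    {a b : V} {p : Path a b} (hp : p.length < 2) : NonzeroPath I p := fun hI => by
  have := h.2 _ hI ⟨a, b, p⟩ (by rw [PathAlgebra.ofPath, coeff_single_self]; exact one_ne_zero)
  simp only at this
  omega

/-- The combinatorial form of the conditions `(Suf, p)`. -/
def SufCondition (I : TwoSidedIdeal (PathAlgebra K V)) : Prop :=
  ∀ ⦃a b c : V⦄ (p : Path a b) (u : Path a c) (α : c ⟶ b), IsRightSubpath u p →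
    u.length < p.length → ¬ IsRightSubpath (u.cons α) p → NonzeroPath I p →
    NonzeroPath I (u.cons α) → ∃ w : Path a a, p = (w.comp u).cons α

/-- The left-right dual of `SufCondition`. -/
def CosufCondition (I : TwoSidedIdeal (PathAlgebra K V)) : Prop :=
  ∀ ⦃a b c : V⦄ (p : Path a b) (u : Path c b) (α : a ⟶ c), IsLeftSubpath u p →
    u.length < p.length → ¬ IsLeftSubpath (α.toPath.comp u) p → NonzeroPath I p →
    NonzeroPath I (α.toPath.comp u) → ∃ w : Path b b, p = (α.toPath.comp u).comp w

/-- Condition (N), with nonzero paths in place of masts. -/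
def PathConditionN (I : TwoSidedIdeal (PathAlgebra K V)) : Prop :=
  ∀ ⦃e e' : V⦄ (α : e ⟶ e') (p : Path e e'), 0 < p.length → NonzeroPath I p →
    (∃ c' : Path e' e', p = α.toPath.comp c') ∨ ∃ c : Path e e, p = c.cons α

/-- The suffix condition for trivial `u`: an arrow parallel to `p` is either the first arrow of `p`
or leaves `p` at once. -/
theorem SufCondition.pathConditionN {I : TwoSidedIdeal (PathAlgebra K V)} (hadm : IsAdmissible I)
    (h : SufCondition I) : PathConditionN I := by
  intro e e' α p hl hp
  by_cases hα : IsRightSubpath (Path.nil.cons α) p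
  · exact Or.inl hα
  · obtain ⟨w, hw⟩ := h p Path.nil α (isRightSubpath_nil p) hl hα hp (hadm.nonzeroPath (by simp))
    exact Or.inr ⟨w, hw⟩

/-- Condition (N) for `α` and the part `t` of `p` before `u` gives `t = c'α`, since `t` cannot end
in `α`. It remains to see that `u` is an initial segment of `uc'`; otherwise the arrow `β` at which
`u` leaves `uc'` contradicts the suffix condition. -/
theorem SufCondition.cosufCondition {I : TwoSidedIdeal (PathAlgebra K V)} (hadm : IsAdmissible I)
    (h : SufCondition I) : CosufCondition I := by
  rintro a b c p u α ⟨t, rfl⟩ hl hα hp hu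
  simp only [Path.length_comp] at hl
  obtain ⟨c', rfl⟩ | ⟨w, rfl⟩ := h.pathConditionN hadm α t (by omega) hp.left
  swap
  · exact absurd ⟨w, by rw [← Path.comp_assoc, Path.comp_toPath_eq_cons]⟩ hα
  by_cases hc : IsRightSubpath u (c'.comp u)
  · obtain ⟨w, hw⟩ := hc
    exact ⟨w, by rw [Path.comp_assoc, hw, Path.comp_assoc]⟩
  exfalso
  obtain ⟨d, e, s, β, r, hr, hs, hs'⟩ := exists_break _ _ hc
  have h1 : IsRightSubpath (c'.comp (s.cons β)) (c'.comp u) :=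
    IsRightSubpath.comp_left ⟨r, hr⟩ c'
  have h2 : IsRightSubpath s (c'.comp (s.cons β)) := hs.of_length_le h1 (by simp; omega)
  -- The detour `(β, sα)` on `βsc'α` yields `βsc'α = βsαw`. Cancelling `βs` leaves `c'α = αw`, so
  -- that `p = uc'α = uαw` ends in `uα`, which was excluded.
  obtain ⟨w, hw⟩ := h (α.toPath.comp (c'.comp (s.cons β))) (α.toPath.comp s) β
    (h2.comp_left _) (by simp) (fun h3 => hs' ((IsRightSubpath.of_comp_left
      (w := α.toPath) (by simpa using h3)).trans h1))
    (hp.of_isRightSubpath (by rw [Path.comp_assoc]; exact h1.comp_left _))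
    (hu.of_isRightSubpath (IsRightSubpath.comp_left (u := s.cons β) ⟨r, hr⟩ α.toPath))
  simp only [Path.comp_cons] at hw
  have h4 := (cons_inj hw).1
  rw [← Path.comp_assoc, ← Path.comp_assoc, Path.comp_inj_left] at h4
  exact hα ⟨w, by rw [h4, Path.comp_assoc]⟩

/-! ### Vertex sequences -/

theorem eq_of_vertices_eq {I : TwoSidedIdeal (PathAlgebra K V)} {a : V}
    (hpar : ∀ ⦃c d : V⦄ (u : Path a c) (β β' : c ⟶ d), NonzeroPath I (u.cons β) →
      NonzeroPath I (u.cons β') → β = β') {b : V} (p q : Path a b)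
    (h : p.vertices = q.vertices) (hp : NonzeroPath I p) (hq : NonzeroPath I q) : p = q := by
  induction p with
  | nil =>
    have := congrArg List.length h
    simp only [Path.vertices_length, Path.length_nil] at this
    exact (Path.eq_nil_of_length_zero q (by omega)).symm
  | @cons c d p e ih =>
    cases q with
    | nil =>
      have := congrArg List.length h
      simp at this
    | @cons c' _ q e' =>
      simp only [Path.vertices_cons, List.concat_eq_append] at h
      have h1 := List.append_cancel_right h
      have h2 := p.vertices_getLast
      simp only [h1, Path.vertices_getLast] at h2
      subst h2
      obtain rfl := ih q h1 (hp.of_isRightSubpath ⟨e.toPath, by simp⟩)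
        (hq.of_isRightSubpath ⟨e'.toPath, by simp⟩)
      rw [hpar _ _ _ hp hq]

/-- For a path of length one the cycles in condition (N) are trivial. -/
theorem PathConditionN.arrow_eq {I : TwoSidedIdeal (PathAlgebra K V)} (hadm : IsAdmissible I)
    (h : PathConditionN I) {c d : V} (β β' : c ⟶ d) : β = β' := by
  obtain ⟨r, hr⟩ | ⟨r, hr⟩ := h β β'.toPath (by simp) (hadm.nonzeroPath (by simp))
  · have := congrArg Path.length hr
    simp only [Path.length_comp, Path.length_toPath] at this
    rw [Path.eq_nil_of_length_zero r (by omega)] at hr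
    exact (cons_inj hr).2.symm
  · have := congrArg Path.length hr
    simp only [Path.length_cons, Path.length_toPath] at this
    rw [Path.eq_nil_of_length_zero r (by omega)] at hr
    exact (cons_inj hr).2.symm

/-- The path through `(e(0), …, e(i), e(j+1))` is `βu`, where `u` is the initial segment of `p` of
length `i`, because there are no parallel arrows. It leaves the segment `v` of length `j + 1`, as
`e(i+1) ≠ e(j+1)`, and `v = βuw` makes the vertices of `u` a suffix of those of `v` without its last
arrow. -/
theorem SufCondition.repeatedSegments {I : TwoSidedIdeal (PathAlgebra K V)}
    (hadm : IsAdmissible I) (h : SufCondition I) : RepeatedSegments I := by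
  rintro l e a b p hpv hp i j hij hjl - hne ⟨a', b', q, hqv, hq⟩
  have hpl := congrArg List.length hpv
  simp only [Path.vertices_length, vertexSeq, List.length_map, List.length_range] at hpl
  have hpar : ∀ ⦃c d : V⦄ (β β' : c ⟶ d), β = β' := fun _ _ =>
    (h.pathConditionN hadm).arrow_eq hadm
  obtain ⟨c, u, hu, hul⟩ := exists_isRightSubpath_length p (n := i) (by omega)
  obtain ⟨d, v, hv, hvl⟩ := exists_isRightSubpath_length p (n := j + 1) (by omega)
  have huv := vertices_isRightSubpath hu hpv
  have hvv := vertices_isRightSubpath hv hpv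
  rw [hul] at huv
  rw [hvl] at hvv
  cases q with
  | nil =>
    have := congrArg List.length hqv
    simp [vertexSeq] at this
  | @cons c' _ q β =>
    simp only [Path.vertices_cons, List.concat_eq_append] at hqv
    obtain ⟨hqv, hb⟩ := List.append_inj' hqv rfl
    obtain rfl : b' = d := by
      rw [end_eq_of_vertices hvv]; simpa using hb
    obtain rfl : a' = a := by
      rw [start_eq_of_vertices hqv, start_eq_of_vertices hpv]
    obtain rfl : c' = c := by
      rw [end_eq_of_vertices hqv, end_eq_of_vertices huv]
    obtain rfl := eq_of_vertices_eq (fun _ _ _ β β' _ _ => hpar β β') q u (hqv.trans huv.symm)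
      (hq.of_isRightSubpath ⟨β.toPath, by simp⟩) (hp.of_isRightSubpath hu)
    have hnot : ¬ IsRightSubpath (q.cons β) v := fun h3 => by
      have h4 := vertices_isRightSubpath (h3.trans hv) hpv
      rw [Path.length_cons, hul] at h4
      exact hne (by rw [← end_eq_of_vertices h4, ← end_eq_of_vertices hvv])
    obtain ⟨w, hw⟩ := h v q β (hu.of_length_le hv (by omega)) (by omega) hnot
      (hp.of_isRightSubpath hv) hq
    have h4 := hvv
    rw [hw, Path.vertices_cons, List.concat_eq_append, vertexSeq_succ] at h4
    have h5 := (List.append_inj' h4 rfl).1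
    rw [Path.vertices_comp, huv] at h5
    exact ⟨_, h5⟩

/-- By (N) the rest `r` of `p` after `u` ends in `α`, say `r = αm` with a cycle `m`. The vertex
where `u` ends is thus repeated after `m`, and the segment condition shows that `mu` ends in `u`. -/
theorem sufCondition_of_repeatedSegments {I : TwoSidedIdeal (PathAlgebra K V)}
    (hadm : IsAdmissible I) (hN : PathConditionN I) (hR : RepeatedSegments I) :
    SufCondition I := by
  rintro a b c p u α ⟨r, rfl⟩ hl hα hp hu
  simp only [Path.length_comp] at hl
  have hpar : ∀ ⦃c d : V⦄ (β β' : c ⟶ d), β = β' := fun _ _ => hN.arrow_eq hadm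
  have hαr : ¬ IsRightSubpath α.toPath r := fun h => hα (by simpa using h.comp_left u)
  obtain ⟨c', hc⟩ | ⟨m, rfl⟩ := hN α r (by omega) hp.right
  · exact absurd ⟨c', hc⟩ hαr
  set p := u.comp (m.cons α) with hpdef
  have hm : 0 < m.length := by
    by_contra h
    obtain rfl := Path.eq_nil_of_length_zero m (by omega)
    exact hαr (isRightSubpath_refl _)
  have hev := vertices_eq_vertexSeq p
  set e : ℕ → V := fun k => p.vertices.getD k a
  have hpl : p.length = u.length + m.length + 1 := by simp [hpdef, add_assoc]
  have hum : IsRightSubpath (u.comp m) p := ⟨α.toPath, by simp [hpdef]⟩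
  have huv := vertices_isRightSubpath ((isRightSubpath_comp u m).trans hum) hev
  have humv := vertices_isRightSubpath hum hev
  rw [Path.length_comp] at humv
  have hb := end_eq_of_vertices hev
  rw [hpl] at hb
  -- `γ` is the first arrow of `m`. If it ended where `α` ends, it would equal `α`, and `αu` would
  -- be an initial segment of `p`.
  obtain ⟨d, γ, s, -, hsl⟩ := (m.cons α).eq_toPath_comp_of_length_eq_succ
    (n := m.length) (by simp)
  have huγ : IsRightSubpath (u.cons γ) p := ⟨s, by
    rw [hpdef, hsl, ← Path.comp_assoc, Path.comp_toPath_eq_cons]⟩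
  have hd := end_eq_of_vertices (vertices_isRightSubpath huγ hev)
  rw [Path.length_cons] at hd
  have hsuf := hR p.length e a b p hev hp u.length (u.length + m.length) (by omega) (by omega)
    (by rw [← end_eq_of_vertices huv, ← end_eq_of_vertices humv]) (fun h3 => by
      rw [← hd, ← hb] at h3
      subst h3
      rw [hpar γ α] at huγ
      exact hα huγ)
    ⟨a, b, u.cons α, by rw [Path.vertices_cons, List.concat_eq_append, huv, ← hb], hu⟩
  rw [← huv, ← humv] at hsuf
  -- The terminal segment `t` of `mu` of the length of `u` has the same vertices as `u`, hence
  -- equals `u`.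
  obtain ⟨a', w, t, hwt, hwl⟩ := (u.comp m).exists_eq_comp_of_le_length
    (n := m.length) (by simp)
  have htl : t.length = u.length := by
    have := congrArg Path.length hwt
    simp only [Path.length_comp] at this
    omega
  have htv : t.vertices = u.vertices := by
    have h1 : t.vertices <:+ (u.comp m).vertices := by
      rw [hwt, Path.vertices_comp]; exact List.suffix_append _ _
    exact (List.suffix_of_suffix_length_le h1 hsuf (by simp [htl])).eq_of_length (by simp [htl])
  obtain rfl : a' = a := by
    have h1 := t.vertices_head?
    rw [htv, Path.vertices_head?] at h1
    simpa using h1.symm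
  have hP : NonzeroPath I (u.comp m) := hp.of_isRightSubpath hum
  obtain rfl := eq_of_vertices_eq (fun _ _ _ β β' _ _ => hpar β β') t u htv
    (by rw [hwt] at hP; exact hP.right) hP.left
  exact ⟨w, by rw [hpdef, Path.comp_cons, hwt]⟩

end Conditions

/-! ### The radical filtration of a module over a bound quiver algebra -/

section Filtration

variable {K : Type u} {V : Type v} [Field K] [Quiver.{w} V] [Finite V]
  {I : TwoSidedIdeal (PathAlgebra K V)}

theorem mk_surjective (I : TwoSidedIdeal (PathAlgebra K V)) :
    Function.Surjective (I.ringCon.mk' : PathAlgebra K V → BoundAlgebra I) :=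
  I.ringCon.mk'_surjective

theorem mk_eq_zero {z : PathAlgebra K V} : I.ringCon.mk' z = 0 ↔ z ∈ I := by
  rw [← map_zero I.ringCon.mk', TwoSidedIdeal.mem_iff]
  exact RingCon.eq _

theorem mk_smul (c : K) (z : PathAlgebra K V) :
    I.ringCon.mk' (c • z) = c • I.ringCon.mk' z := rfl

theorem pathClass_eq_zero {a b : V} {p : Path a b} : pathClass I p = 0 ↔ ¬ NonzeroPath I p := by
  rw [NonzeroPath, not_not, pathClass, mk_eq_zero]

theorem pathClass_mul {a b c : V} (p : Path a b) (q : Path b c) :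
    pathClass I q * pathClass I p = pathClass I (p.comp q) := by
  rw [pathClass, pathClass, ← map_mul, PathAlgebra.ofPath_mul_ofPath, pathClass]

theorem pathClass_mul_of_ne {a b c d : V} (p : Path a b) (q : Path c d) (h : c ≠ b) :
    pathClass I q * pathClass I p = 0 := by
  rw [pathClass, pathClass, ← map_mul, PathAlgebra.ofPath_mul_ofPath_of_ne _ _ h, map_zero]

theorem sum_pathClass_nil [Fintype V] :
    ∑ e : V, pathClass I (Path.nil : Path e e) = 1 := by
  rw [← map_one I.ringCon.mk', PathAlgebra.one_def, map_sum]
  rfl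

theorem span_pathClass (I : TwoSidedIdeal (PathAlgebra K V)) :
    Submodule.span K (Set.range fun p : AnyPath V => pathClass I p.2.2) = ⊤ := by
  rw [eq_top_iff]
  rintro x -
  obtain ⟨z, rfl⟩ := mk_surjective I x
  rw [← PathAlgebra.pathBasis.linearCombination_repr z, Finsupp.linearCombination_apply,
    Finsupp.sum, map_sum]
  refine Submodule.sum_mem _ fun p _ => ?_
  rw [mk_smul]
  exact Submodule.smul_mem _ _ (Submodule.subset_span ⟨p, rfl⟩)

variable {U : Type*} [AddCommGroup U] [Module (BoundAlgebra I) U]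

theorem pathClass_smul_smul {a b c : V} (p : Path a b) (q : Path b c) (y : U) :
    pathClass I q • pathClass I p • y = pathClass I (p.comp q) • y := by
  rw [← mul_smul, pathClass_mul]

theorem pathClass_smul_smul_of_ne {a b c d : V} (p : Path a b) (q : Path c d) (y : U)
    (h : c ≠ b) : pathClass I q • pathClass I p • y = 0 := by
  rw [← mul_smul, pathClass_mul_of_ne _ _ h, zero_smul]

theorem pathClass_smul_of_ne {a c d : V} {x : U} (hx : pathClass I (Path.nil : Path a a) • x = x)
    (q : Path c d) (h : c ≠ a) : pathClass I q • x = 0 := by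
  rw [← hx, pathClass_smul_smul_of_ne _ _ _ h]

theorem NonzeroPath.of_smul_ne_zero {c d : V} {q : Path c d} {y : U}
    (h : pathClass I q • y ≠ 0) : NonzeroPath I q := by
  by_contra hq
  rw [pathClass_eq_zero.2 hq, zero_smul] at h
  exact h rfl

variable (I U) in
/-- The `n`-th power of the arrow ideal, applied to `U`. -/
def rad (n : ℕ) : Submodule (BoundAlgebra I) U :=
  Submodule.span (BoundAlgebra I)
    {y | ∃ (a b : V) (q : Path a b) (z : U), n ≤ q.length ∧ y = pathClass I q • z}

theorem pathClass_smul_mem_rad {a b : V} (q : Path a b) (z : U) {n : ℕ} (h : n ≤ q.length) :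
    pathClass I q • z ∈ rad I U n :=
  Submodule.subset_span ⟨a, b, q, z, h, rfl⟩

theorem rad_antitone : Antitone (rad I U) := fun _ _ h =>
  Submodule.span_mono fun _ ⟨a, b, q, z, hq, hy⟩ => ⟨a, b, q, z, h.trans hq, hy⟩

theorem rad_zero : rad I U 0 = ⊤ := by
  let _ := Fintype.ofFinite V
  rw [eq_top_iff]
  rintro y -
  rw [← one_smul (BoundAlgebra I) y, ← sum_pathClass_nil, Finset.sum_smul]
  exact Submodule.sum_mem _ fun e _ => pathClass_smul_mem_rad _ _ (Nat.zero_le _)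

theorem exists_rad_eq_bot (hadm : IsAdmissible I) : ∃ N, rad I U N = ⊥ := by
  obtain ⟨N, hN⟩ := hadm.1
  refine ⟨N, ?_⟩
  rw [rad, Submodule.span_eq_bot]
  rintro y ⟨a, b, q, z, hq, rfl⟩
  rw [pathClass_eq_zero.2 (not_not.2 (hN _ _ q hq)), zero_smul]

variable [Module K U] [IsScalarTower K (BoundAlgebra I) U]

/-- To check a `K`-linear property of all multiples of `y`, it suffices to look at paths. -/
theorem smul_mem_of_forall_path (W : Submodule K U) (y : U)
    (h : ∀ (a b : V) (q : Path a b), pathClass I q • y ∈ W) (r : BoundAlgebra I) : r • y ∈ W := by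
  have hr : r ∈ Submodule.span K (Set.range fun p : AnyPath V => pathClass I p.2.2) := by
    rw [span_pathClass]; trivial
  induction hr using Submodule.span_induction with
  | mem r hr =>
    obtain ⟨p, rfl⟩ := hr
    exact h _ _ _
  | zero => rw [zero_smul]; exact W.zero_mem
  | add r s _ _ hr hs => rw [add_smul]; exact W.add_mem hr hs
  | smul c r _ hr => rw [smul_assoc]; exact W.smul_mem c hr

theorem pathClass_smul_comm {a b : V} (q : Path a b) (c : K) (y : U) :
    pathClass I q • c • y = c • pathClass I q • y := by
  rw [← one_smul (BoundAlgebra I) y, ← smul_assoc c, ← mul_smul, ← mul_smul, ← smul_assoc,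
    mul_smul_comm]

/-- The generators of `rad n`, together with zero, are stable under multiplication by paths, so `rad
n` is already their `K`-span. This allows tests with subspaces that are not submodules. -/
theorem rad_le_of_forall_path (W : Submodule K U) (n : ℕ)
    (h : ∀ (a b : V) (q : Path a b) (y : U), n ≤ q.length → pathClass I q • y ∈ W) :
    ∀ y ∈ rad I U n, y ∈ W := by
  have key : ∀ y ∈ rad I U n, ∀ r : BoundAlgebra I, r • y ∈ W := by
    intro y hy
    induction hy using Submodule.span_induction with
    | mem y hy =>
      obtain ⟨a, b, q, z, hq, rfl⟩ := hy
      refine smul_mem_of_forall_path W _ fun c d r => ?_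
      by_cases hc : c = b
      · subst hc
        rw [pathClass_smul_smul]
        exact h _ _ _ _ (by rw [Path.length_comp]; omega)
      · rw [pathClass_smul_smul_of_ne _ _ _ hc]
        exact W.zero_mem
    | zero => intro r; rw [smul_zero]; exact W.zero_mem
    | add y z _ _ hy hz => intro r; rw [smul_add]; exact W.add_mem (hy r) (hz r)
    | smul s y _ hy => intro r; rw [← mul_smul]; exact hy _
  intro y hy
  simpa using key y hy 1

/-- Multiplication by `q` is only `K`-linear, so the preimage of `rad m` is a subspace, and it is
tested on the elements `rz` with `r` a path of length at least `n`. -/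
theorem pathClass_smul_rad {a b : V} (q : Path a b) {n m : ℕ} (hm : m ≤ n + q.length) {y : U}
    (hy : y ∈ rad I U n) : pathClass I q • y ∈ rad I U m := by
  let W : Submodule K U :=
    { carrier := {z | pathClass I q • z ∈ rad I U m}
      zero_mem' := by simp
      add_mem' := fun {x y} hx hy => by
        simp only [Set.mem_ofPred_eq] at *
        rw [smul_add]; exact Submodule.add_mem _ hx hy
      smul_mem' := fun c x hx => by
        simp only [Set.mem_ofPred_eq] at *
        rw [pathClass_smul_comm]; exact Submodule.smul_of_tower_mem _ c hx }
  refine rad_le_of_forall_path W n (fun c d r z hr => ?_) y hy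
  change pathClass I q • pathClass I r • z ∈ rad I U m
  by_cases hd : a = d
  · subst hd
    rw [pathClass_smul_smul]
    exact pathClass_smul_mem_rad _ _ (by rw [Path.length_comp]; omega)
  · rw [pathClass_smul_smul_of_ne _ _ _ hd]
    exact Submodule.zero_mem _

/-- If `x` generates `U`, the filtration is spanned by the multiples of `x` by long paths. -/
theorem rad_le_of_generator (W : Submodule K U) (n : ℕ) {a : V} {x : U}
    (hx : pathClass I (Path.nil : Path a a) • x = x)
    (hgen : Submodule.span (BoundAlgebra I) {x} = ⊤)
    (h : ∀ (b : V) (q : Path a b), n ≤ q.length → pathClass I q • x ∈ W) :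
    ∀ y ∈ rad I U n, y ∈ W := by
  refine rad_le_of_forall_path W n fun c d q y hq => ?_
  have hy : y ∈ Submodule.span (BoundAlgebra I) {x} := by rw [hgen]; trivial
  obtain ⟨r, rfl⟩ := Submodule.mem_span_singleton.1 hy
  let W' : Submodule K U :=
    { carrier := {z | pathClass I q • z ∈ W}
      zero_mem' := by simp
      add_mem' := fun {x y} hx hy => by
        simp only [Set.mem_ofPred_eq] at *
        rw [smul_add]; exact Submodule.add_mem _ hx hy
      smul_mem' := fun c x hx => by
        simp only [Set.mem_ofPred_eq] at *
        rw [pathClass_smul_comm]; exact W.smul_mem c hx }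
  refine smul_mem_of_forall_path W' x (fun e f s => ?_) r
  change pathClass I q • pathClass I s • x ∈ W
  by_cases hc : c = f
  · subst hc
    rw [pathClass_smul_smul]
    by_cases he : e = a
    · subst he
      exact h _ _ (by rw [Path.length_comp]; omega)
    · rw [pathClass_smul_of_ne hx _ he]
      exact W.zero_mem
  · rw [pathClass_smul_smul_of_ne _ _ _ hc]
    exact W.zero_mem

/-- The `K`-subspace `K y + rad n`. -/
def lineAddRad (n : ℕ) (y : U) : Submodule K U :=
  Submodule.span K {y} ⊔ (rad I U n).restrictScalars K

theorem mem_lineAddRad {n : ℕ} {y z : U} :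
    z ∈ lineAddRad (K := K) (I := I) n y ↔ ∃ c : K, z - c • y ∈ rad I U n := by
  rw [lineAddRad, Submodule.mem_sup]
  constructor
  · rintro ⟨_, hs, t, ht, rfl⟩
    obtain ⟨c, rfl⟩ := Submodule.mem_span_singleton.1 hs
    exact ⟨c, by simpa using ht⟩
  · rintro ⟨c, hc⟩
    exact ⟨c • y, Submodule.mem_span_singleton.2 ⟨c, rfl⟩, _, hc, by abel⟩

/-- On `y = e_b y` the vertices act as zero or one, and paths of positive length lead into the next
layer. -/
theorem exists_smul_sub_mem_rad {b : V} {n : ℕ} {y : U}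
    (hb : pathClass I (Path.nil : Path b b) • y = y) (hy : y ∈ rad I U n) (r : BoundAlgebra I) :
    ∃ c : K, r • y - c • y ∈ rad I U (n + 1) := by
  rw [← mem_lineAddRad]
  refine smul_mem_of_forall_path _ _ (fun c d q => ?_) r
  rw [mem_lineAddRad]
  by_cases hc : c = b
  · subst hc
    by_cases hq : q.length = 0
    · obtain rfl := Path.eq_of_length_zero q hq
      refine ⟨1, ?_⟩
      rw [Path.eq_nil_of_length_zero q hq, hb, one_smul, sub_self]
      exact Submodule.zero_mem _
    · refine ⟨0, ?_⟩
      rw [zero_smul, sub_zero]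
      exact pathClass_smul_rad (K := K) q (by omega) hy
  · refine ⟨0, ?_⟩
    rw [pathClass_smul_of_ne hb _ hc, zero_smul, sub_zero]
    exact Submodule.zero_mem _

/-- In a module whose submodules form a chain, the layers of the radical filtration are at most
one-dimensional. -/
theorem exists_sub_smul_mem_rad_of_chain
    (hU : ∀ N N' : Submodule (BoundAlgebra I) U, N ≤ N' ∨ N' ≤ N) {b : V} {n : ℕ} {y : U}
    (hb : pathClass I (Path.nil : Path b b) • y = y) (hy : y ∈ rad I U n)
    (hy' : y ∉ rad I U (n + 1)) {z : U} (hz : z ∈ rad I U n) :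
    ∃ c : K, z - c • y ∈ rad I U (n + 1) := by
  let _ := Fintype.ofFinite V
  rw [← mem_lineAddRad, ← one_smul (BoundAlgebra I) z, ← sum_pathClass_nil, Finset.sum_smul]
  refine Submodule.sum_mem _ fun e _ => ?_
  set t := pathClass I (Path.nil : Path e e) • z with ht
  have hte : pathClass I (Path.nil : Path e e) • t = t := by
    rw [ht, pathClass_smul_smul, Path.comp_nil]
  have htn : t ∈ rad I U n := Submodule.smul_mem _ _ hz
  rw [mem_lineAddRad]
  obtain h | h := hU (Submodule.span (BoundAlgebra I) {t}) (Submodule.span (BoundAlgebra I) {y})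
  · obtain ⟨r, hr⟩ := Submodule.mem_span_singleton.1 (h (Submodule.mem_span_singleton_self t))
    rw [← hr]
    exact exists_smul_sub_mem_rad hb hy r
  -- Here `y = rt` is congruent to `ct`, and `c ≠ 0` because `y` is not in the next layer; so `t` is
  -- congruent to `c⁻¹y`.
  · obtain ⟨r, hr⟩ := Submodule.mem_span_singleton.1 (h (Submodule.mem_span_singleton_self y))
    obtain ⟨c, hc⟩ := exists_smul_sub_mem_rad (K := K) hte htn r
    rw [hr] at hc
    have hc0 : c ≠ 0 := by
      rintro rfl
      exact hy' (by simpa using hc)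
    refine ⟨c⁻¹, ?_⟩
    have := Submodule.smul_of_tower_mem (rad I U (n + 1)) (-c⁻¹) hc
    rwa [smul_sub, smul_smul, neg_mul, inv_mul_cancel₀ hc0, neg_smul, neg_smul, one_smul,
      sub_neg_eq_add, neg_add_eq_sub] at this

/-! ### Generators adapted to a path -/

variable (I) in
/-- The element `x` generates `U`, and the layers of the radical filtration of `U` are spanned by
the multiples of `x` by the initial segments of `p`. -/
structure IsAdapted {a b : V} (p : Path a b) (x : U) : Prop where
  unit : pathClass I (Path.nil : Path a a) • x = x
  ne_zero : pathClass I p • x ≠ 0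
  span_eq : Submodule.span (BoundAlgebra I) {x} = ⊤
  rad_eq_bot : rad I U (p.length + 1) = ⊥
  layer : ∀ (c : V) (v : Path a c), IsRightSubpath v p → ∀ z ∈ rad I U v.length,
    ∃ k : K, z - k • pathClass I v • x ∈ rad I U (v.length + 1)

/-- Multiplying by the rest of `p` after `v` would push `px` into `rad (p.length + 1) = ⊥`. -/
theorem notMem_rad_of_ne_zero {a b c : V} {p : Path a b} {v : Path a c} {x : U}
    (hp : pathClass I p • x ≠ 0) (hbot : rad I U (p.length + 1) = ⊥) (hv : IsRightSubpath v p) :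
    pathClass I v • x ∉ rad I U (v.length + 1) := by
  obtain ⟨r, rfl⟩ := hv
  intro h
  have h1 := pathClass_smul_rad (K := K) (m := (v.comp r).length + 1) r
    (by rw [Path.length_comp]; omega) h
  rw [pathClass_smul_smul, hbot, Submodule.mem_bot] at h1
  exact hp h1

/-- Nakayama's lemma for the arrow ideal. -/
theorem eq_top_of_sup_rad_one (hadm : IsAdmissible I) {S : Submodule (BoundAlgebra I) U}
    (hS : S ⊔ rad I U 1 = ⊤) : S = ⊤ := by
  have hstep : ∀ n, rad I U n ≤ S ⊔ rad I U (n + 1) := by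
    intro n
    refine Submodule.span_le.2 ?_
    rintro _ ⟨c, d, q, z, hq, rfl⟩
    -- Splitting `z` along `S ⊔ rad 1` moves `qz` one layer down modulo `S`; as the filtration
    -- reaches zero, `S` is everything.
    obtain ⟨s, hs, t, ht, rfl⟩ := Submodule.mem_sup.1 (show z ∈ S ⊔ rad I U 1 by rw [hS]; trivial)
    rw [SetLike.mem_coe, smul_add]
    exact Submodule.add_mem_sup (S.smul_mem _ hs) (pathClass_smul_rad (K := K) q (by omega) ht)
  have hall : ∀ n, S ⊔ rad I U n = ⊤ := by
    intro n
    induction n with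
    | zero => rw [rad_zero, sup_top_eq]
    | succ n ih =>
      rw [eq_top_iff, ← ih]
      exact sup_le le_sup_left (hstep n)
  obtain ⟨N, hN⟩ := exists_rad_eq_bot (U := U) hadm
  rw [← hall N, hN, sup_bot_eq]

theorem span_eq_top_of_chain (hadm : IsAdmissible I)
    (hU : ∀ N N' : Submodule (BoundAlgebra I) U, N ≤ N' ∨ N' ≤ N) {a : V} {x : U}
    (ha : pathClass I (Path.nil : Path a a) • x = x) (hx : x ∉ rad I U 1) :
    Submodule.span (BoundAlgebra I) {x} = ⊤ := by
  refine eq_top_of_sup_rad_one (K := K) hadm (eq_top_iff.2 fun z _ => ?_)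
  obtain ⟨k, hk⟩ := exists_sub_smul_mem_rad_of_chain (K := K) hU ha (n := 0)
    (by rw [rad_zero]; trivial) hx (z := z) (by rw [rad_zero]; trivial)
  rw [← add_sub_cancel (k • x) z]
  exact Submodule.add_mem_sup
    (Submodule.smul_of_tower_mem _ k (Submodule.mem_span_singleton_self x)) hk

theorem isAdapted_of_chain (hadm : IsAdmissible I)
    (hU : ∀ N N' : Submodule (BoundAlgebra I) U, N ≤ N' ∨ N' ≤ N) {a b : V} {p : Path a b} {x : U}
    (ha : pathClass I (Path.nil : Path a a) • x = x) (hp : pathClass I p • x ≠ 0)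
    (hbot : rad I U (p.length + 1) = ⊥) : IsAdapted I p x where
  unit := ha
  ne_zero := hp
  span_eq := span_eq_top_of_chain (K := K) hadm hU ha (by
    have := notMem_rad_of_ne_zero (K := K) hp hbot (isRightSubpath_nil p)
    rwa [ha] at this)
  rad_eq_bot := hbot
  layer := fun c v hv z hz => exists_sub_smul_mem_rad_of_chain hU (b := c)
    (by rw [pathClass_smul_smul, Path.comp_nil]) (pathClass_smul_mem_rad _ _ le_rfl)
    (notMem_rad_of_ne_zero (K := K) hp hbot hv) hz

/-- By Nakayama some `x = e_a y` lies outside `rad 1`. A longest path `p` with `px ≠ 0` is the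
required one: by maximality `rad (p.length + 1)` vanishes. -/
theorem exists_isAdapted_of_chain [Nontrivial U] (hadm : IsAdmissible I)
    (hU : ∀ N N' : Submodule (BoundAlgebra I) U, N ≤ N' ∨ N' ≤ N) :
    ∃ (a b : V) (p : Path a b) (x : U), IsAdapted I p x := by
  let _ := Fintype.ofFinite V
  obtain ⟨N, hN⟩ := exists_rad_eq_bot (U := U) hadm
  have h1 : rad I U 1 ≠ ⊤ := fun h1 =>
    bot_ne_top (eq_top_of_sup_rad_one (U := U) hadm (S := ⊥) (by rw [h1, bot_sup_eq]))
  obtain ⟨y, -, hy⟩ := SetLike.exists_of_lt h1.lt_top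
  obtain ⟨a, ha⟩ : ∃ a : V, pathClass I (Path.nil : Path a a) • y ∉ rad I U 1 := by
    by_contra! h
    apply hy
    rw [← one_smul (BoundAlgebra I) y, ← sum_pathClass_nil, Finset.sum_smul]
    exact Submodule.sum_mem _ fun e _ => h e
  set x := pathClass I (Path.nil : Path a a) • y with hx
  have hax : pathClass I (Path.nil : Path a a) • x = x := by
    rw [hx, pathClass_smul_smul, Path.comp_nil]
  have hgen := span_eq_top_of_chain (K := K) hadm hU hax ha
  let L : Set ℕ := {n | ∃ (b : V) (p : Path a b), p.length = n ∧ pathClass I p • x ≠ 0}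
  have hLne : L.Nonempty := ⟨0, a, Path.nil, rfl, by
    rw [hax]; rintro h; rw [h] at ha; exact ha (Submodule.zero_mem _)⟩
  have hLb : BddAbove L := by
    refine ⟨N, ?_⟩
    rintro _ ⟨b, p, rfl, hp⟩
    by_contra! h
    have := pathClass_smul_mem_rad (I := I) p x h.le
    rw [hN, Submodule.mem_bot] at this
    exact hp this
  obtain ⟨b, p, hpl, hp⟩ := Nat.sSup_mem hLne hLb
  refine ⟨a, b, p, x, isAdapted_of_chain hadm hU hax hp ?_⟩
  rw [eq_bot_iff]
  intro z hz
  refine rad_le_of_generator (K := K) ⊥ (p.length + 1) hax hgen (fun c q hq => ?_) z hz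
  rw [Submodule.mem_bot]
  by_contra h
  have := le_csSup hLb (⟨c, q, rfl, h⟩ : q.length ∈ L)
  omega

end Filtration

/-! ### Uniserial modules and adapted generators -/

section Adapted

variable {K : Type u} {V : Type v} [Field K] [Quiver.{w} V] [Finite V]
  {I : TwoSidedIdeal (PathAlgebra K V)} {U : Type*} [AddCommGroup U] [Module (BoundAlgebra I) U]
  [Module K U] [IsScalarTower K (BoundAlgebra I) U] {a b : V} {p : Path a b} {x : U}

theorem IsAdapted.notMem_rad (h : IsAdapted I p x) {c : V} {v : Path a c}
    (hv : IsRightSubpath v p) : pathClass I v • x ∉ rad I U (v.length + 1) :=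
  notMem_rad_of_ne_zero (K := K) h.ne_zero h.rad_eq_bot hv

omit [IsScalarTower K (BoundAlgebra I) U] in
theorem IsAdapted.exists_mem_rad (h : IsAdapted I p x) {y : U} (hy : y ≠ 0) :
    ∃ i ≤ p.length, y ∈ rad I U i ∧ y ∉ rad I U (i + 1) := by
  classical
  have hex : ∃ n, y ∉ rad I U n := ⟨p.length + 1, by rwa [h.rad_eq_bot, Submodule.mem_bot]⟩
  have h0 : Nat.find hex ≠ 0 := fun h0 => by
    have := Nat.find_spec hex
    rw [h0, rad_zero] at this
    exact this trivial
  have hle : Nat.find hex ≤ p.length + 1 :=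
    Nat.find_min' hex (by rwa [h.rad_eq_bot, Submodule.mem_bot])
  refine ⟨Nat.find hex - 1, by omega, ?_, ?_⟩
  · exact not_not.1 (Nat.find_min hex (m := Nat.find hex - 1) (by omega))
  · rw [Nat.sub_add_cancel (by omega)]
    exact Nat.find_spec hex

/-- Modulo the next layer, `y` is a nonzero multiple of `vx`, where `v` is the initial segment of
length `i`. Multiplying by the arrows of `p` after `v` reaches every lower layer, so these are
absorbed one by one, starting from the bottom. -/
theorem IsAdapted.rad_le_span (h : IsAdapted I p x) {i : ℕ} (hi : i ≤ p.length) {y : U}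
    (hy : y ∈ rad I U i) (hy' : y ∉ rad I U (i + 1)) :
    rad I U i ≤ Submodule.span (BoundAlgebra I) {y} := by
  set S := Submodule.span (BoundAlgebra I) {y}
  have hyS : y ∈ S := Submodule.mem_span_singleton_self y
  obtain ⟨c, v, hv, hvl⟩ := exists_isRightSubpath_length p hi
  obtain ⟨k, hk⟩ := h.layer c v hv y (by rwa [hvl])
  have hk0 : k ≠ 0 := by
    rintro rfl
    rw [hvl] at hk
    exact hy' (by simpa using hk)
  suffices hall : ∀ n, i ≤ p.length + 1 - n → rad I U (p.length + 1 - n) ≤ S by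
    have := hall (p.length + 1 - i) (by omega)
    rwa [Nat.sub_sub_self (by omega)] at this
  intro n
  induction n with
  | zero => intro _; rw [Nat.sub_zero, h.rad_eq_bot]; exact bot_le
  | succ n ih =>
    intro hn
    -- With truncated subtraction both indices are zero in this case.
    by_cases hnl : p.length + 1 ≤ n
    · rw [Nat.sub_eq_zero_of_le hnl] at ih
      rw [Nat.sub_eq_zero_of_le (by omega)]
      exact ih (by omega)
    specialize ih (by omega)
    obtain ⟨d, t, ht, htl⟩ := exists_isRightSubpath_length p (n := p.length + 1 - (n + 1))
      (by omega)
    rw [show p.length + 1 - n = t.length + 1 by omega] at ih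
    rw [← htl] at hn ⊢
    obtain ⟨r, rfl⟩ := hv.of_length_le ht (by omega)
    have h1 : pathClass I r • (y - k • pathClass I v • x) ∈ S :=
      ih (pathClass_smul_rad (K := K) r (by rw [Path.length_comp]; omega) hk)
    rw [smul_sub, pathClass_smul_comm, pathClass_smul_smul] at h1
    have h2 : k • pathClass I (v.comp r) • x ∈ S := by
      have := S.sub_mem (S.smul_mem (pathClass I r) hyS) h1
      rwa [sub_sub_cancel] at this
    have h3 : pathClass I (v.comp r) • x ∈ S := by
      have := Submodule.smul_of_tower_mem S k⁻¹ h2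
      rwa [smul_smul, inv_mul_cancel₀ hk0, one_smul] at this
    intro z hz
    obtain ⟨k', hk'⟩ := h.layer d _ ht z hz
    have := S.add_mem (ih hk') (Submodule.smul_of_tower_mem S k' h3)
    rwa [sub_add_cancel] at this

theorem IsAdapted.rad_covBy (h : IsAdapted I p x) {i : ℕ} (hi : i ≤ p.length) :
    rad I U (i + 1) ⋖ rad I U i := by
  obtain ⟨c, v, hv, rfl⟩ := exists_isRightSubpath_length p hi
  refine ⟨lt_of_le_of_ne (rad_antitone (Nat.le_succ _)) fun h' => h.notMem_rad hv ?_,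
    fun N h1 h2 => ?_⟩
  · rw [h']
    exact pathClass_smul_mem_rad _ _ le_rfl
  · obtain ⟨y, hyN, hy⟩ := SetLike.exists_of_lt h1
    exact absurd ((h.rad_le_span hi (h2.le hyN) hy).trans
      ((Submodule.span_singleton_le_iff_mem _ _).2 hyN)) (not_le_of_gt h2)

theorem IsAdapted.isUniserial (h : IsAdapted I p x) : IsUniserial (BoundAlgebra I) U := by
  have hx : x ≠ 0 := by
    rintro rfl
    exact h.ne_zero (smul_zero _)
  refine ⟨⟨x, 0, hx⟩, ⟨⟨{x}, by rw [Finset.coe_singleton, h.span_eq]⟩⟩, fun N N' => ?_⟩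
  by_contra! hN
  obtain ⟨⟨y, hy, hy'⟩, hN'⟩ := And.imp_left SetLike.not_le_iff_exists.1 hN
  refine hN' fun z hz => ?_
  by_cases hz0 : z = 0
  · rw [hz0]; exact N.zero_mem
  have hy0 : y ≠ 0 := by
    rintro rfl
    exact hy' N'.zero_mem
  obtain ⟨i, hi, hyi, hyi'⟩ := h.exists_mem_rad hy0
  obtain ⟨j, hj, hzj, hzj'⟩ := h.exists_mem_rad hz0
  obtain hij | hij := le_total i j
  · exact (Submodule.span_singleton_le_iff_mem _ _).2 hy
      (h.rad_le_span hi hyi hyi' (rad_antitone hij hzj))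
  · exact absurd ((Submodule.span_singleton_le_iff_mem _ _).2 hz
      (h.rad_le_span hj hzj hzj' (rad_antitone hij hyi))) hy'

theorem IsAdapted.length_eq (h : IsAdapted I p x) :
    Module.length (BoundAlgebra I) U = p.length + 1 := by
  let s : CompositionSeries (Submodule (BoundAlgebra I) U) :=
    { length := p.length + 1
      toFun := fun i => rad I U (p.length + 1 - i)
      step := fun i => by
        change rad I U (p.length + 1 - i) ⋖ rad I U (p.length + 1 - (i + 1))
        have hi := i.2
        rw [show p.length + 1 - (i : ℕ) = p.length + 1 - (i + 1) + 1 by omega]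
        exact h.rad_covBy (by omega) }
  have := Module.length_compositionSeries s h.rad_eq_bot
    (show rad I U (p.length + 1 - (p.length + 1)) = ⊤ by rw [Nat.sub_self, rad_zero])
  rw [← this]
  rfl

/-- A maximal left ideal that misses `q` would generate `Λ` together with the arrow ideal, contrary
to Nakayama. -/
theorem pathClass_mem_jacobson (hadm : IsAdmissible I) {c d : V} (q : Path c d)
    (hq : 0 < q.length) : pathClass I q ∈ Ring.jacobson (BoundAlgebra I) := by
  rw [Ring.jacobson, Module.jacobson, Submodule.mem_sInf]
  intro m hm
  by_contra hqm
  refine hm.1 (eq_top_of_sup_rad_one (K := K) hadm (hm.2 _ (lt_of_le_of_ne le_sup_left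
    fun h' => hqm ?_)))
  rw [h']
  refine Submodule.mem_sup_right ?_
  have := pathClass_smul_mem_rad (I := I) q (1 : BoundAlgebra I) (n := 1) hq
  rwa [smul_eq_mul, mul_one] at this

end Adapted

/-! ### Adapted generators, masts and top elements -/

section Mast

variable {K : Type u} {V : Type v} [Field K] [Quiver.{w} V] [Finite V]
  {I : TwoSidedIdeal (PathAlgebra K V)} {U : Type (max u v w)} [AddCommGroup U]
  [Module (BoundAlgebra I) U]
  [Module K U] [IsScalarTower K (BoundAlgebra I) U] {a b : V} {p : Path a b} {x : U}

theorem IsAdapted.isMastOf (h : IsAdapted I p x) : IsMastOf I p U :=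
  ⟨h.isUniserial, h.length_eq, x, h.ne_zero⟩

theorem IsAdapted.isTopElement (h : IsAdapted I p x) : IsTopElement I x := by
  refine ⟨fun hx => ?_, a, h.unit.symm⟩
  have hfin : Module.Finite (BoundAlgebra I) U := h.isUniserial.2.1
  have hnt : Nontrivial U := h.isUniserial.1
  have hle := (Submodule.span_singleton_le_iff_mem _ _).2 hx
  rw [h.span_eq, top_le_iff] at hle
  exact (Submodule.FG.jacobson_smul_lt (R := BoundAlgebra I) (N := (⊤ : Submodule _ U)) top_ne_bot
    hfin.1).ne hle

/-- Some path is adapted to `U`, and comparing lengths gives `rad (p.length + 1) = ⊥`. If `py ≠ 0`,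
then `y` is congruent to some `kx` modulo `rad 1`, so `py = k px` and `px ≠ 0`. -/
theorem IsMastOf.isAdapted (hadm : IsAdmissible I) (h : IsMastOf I p U) (hx : IsTopElement I x) :
    IsAdapted I p x := by
  obtain ⟨⟨hnt, -, hU⟩, hl, y, hy⟩ := h
  obtain ⟨a', b', p', x', h'⟩ := exists_isAdapted_of_chain (K := K) hadm hU
  have hll : p'.length = p.length := by
    have := h'.length_eq.symm.trans hl
    have h2 : p'.length + 1 = p.length + 1 := by exact_mod_cast this
    omega
  have hbot : rad I U (p.length + 1) = ⊥ := by rw [← hll]; exact h'.rad_eq_bot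
  obtain ⟨hxJ, e, he⟩ := hx
  have hx1 : x ∉ rad I U 1 := by
    refine fun h1 => hxJ ((show rad I U 1 ≤ _ from Submodule.span_le.2 ?_) h1)
    rintro _ ⟨c, d, q, z, hq, rfl⟩
    exact Submodule.smul_mem_smul (pathClass_mem_jacobson hadm q hq) trivial
  have hgen := span_eq_top_of_chain (K := K) hadm hU he.symm hx1
  obtain ⟨r, rfl⟩ := Submodule.mem_span_singleton.1
    (show y ∈ Submodule.span (BoundAlgebra I) {x} by rw [hgen]; trivial)
  obtain ⟨k, hk⟩ := exists_smul_sub_mem_rad (K := K) (n := 0) he.symm (by rw [rad_zero]; trivial) r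
  have hpk := pathClass_smul_rad (K := K) (m := p.length + 1) p (by omega) hk
  rw [hbot, Submodule.mem_bot, smul_sub, pathClass_smul_comm, sub_eq_zero] at hpk
  have hpx : pathClass I p • x ≠ 0 := by
    intro h0
    rw [h0, smul_zero] at hpk
    exact hy hpk
  obtain rfl : a = e := by
    by_contra hne
    exact hpx (pathClass_smul_of_ne he.symm p hne)
  exact isAdapted_of_chain hadm hU he.symm hpx hbot

end Mast

/-! ### Standard generators -/

section Standard

variable {K : Type u} {V : Type v} [Field K] [Quiver.{w} V] [Finite V]
  {I : TwoSidedIdeal (PathAlgebra K V)} {U : Type*} [AddCommGroup U] [Module (BoundAlgebra I) U]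

variable (I) in
/-- The element `x` generates `U` and is annihilated by all paths but the initial segments
of `p`. -/
structure IsStandard {a b : V} (p : Path a b) (x : U) : Prop where
  unit : pathClass I (Path.nil : Path a a) • x = x
  ne_zero : pathClass I p • x ≠ 0
  span_eq : Submodule.span (BoundAlgebra I) {x} = ⊤
  kill : ∀ (c : V) (q : Path a c), ¬ IsRightSubpath q p → pathClass I q • x = 0

variable [Module K U] [IsScalarTower K (BoundAlgebra I) U] {a b : V} {p : Path a b} {x : U}

theorem mk_smul_eq_sum (z : PathAlgebra K V) (x : U) :
    I.ringCon.mk' z • x =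
      (PathAlgebra.pathBasis.repr z).sum fun q c => c • pathClass I q.2.2 • x := by
  conv_lhs => rw [← PathAlgebra.pathBasis.linearCombination_repr z,
    Finsupp.linearCombination_apply, Finsupp.sum, map_sum, Finset.sum_smul]
  refine Finset.sum_congr rfl fun q _ => ?_
  rw [mk_smul, smul_assoc]
  rfl

/-- The elements `vx`, for `v` an initial segment of `p`, are linearly independent: multiplying a
relation by the rest `r` of `p` after `v` isolates the coefficient of `v` once the shorter ones are
known to vanish. The annihilator of `x` therefore depends on `p` alone. -/
theorem IsStandard.mk_smul_eq_zero_iff (h : IsStandard I p x) (z : PathAlgebra K V) :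
    I.ringCon.mk' z • x = 0 ↔ ∀ (c : V) (v : Path a c), IsRightSubpath v p →
      z.coeff ⟨a, c, v⟩ = 0 := by
  constructor
  · intro hz
    suffices hall : ∀ n, ∀ (c : V) (v : Path a c), IsRightSubpath v p → v.length = n →
        z.coeff ⟨a, c, v⟩ = 0 from fun c v hv => hall _ c v hv rfl
    intro n
    induction n using Nat.strong_induction_on with
    | _ n ih =>
      rintro c v ⟨r, hr⟩ rfl
      have h1 : pathClass I r • I.ringCon.mk' z • x = 0 := by rw [hz, smul_zero]
      rw [mk_smul_eq_sum, Finsupp.sum, Finset.smul_sum, Finset.sum_eq_single ⟨a, c, v⟩] at h1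
      · rw [pathClass_smul_comm, pathClass_smul_smul, ← hr] at h1
        exact (smul_eq_zero.1 h1).resolve_right h.ne_zero
      · rintro ⟨a', c', q⟩ - hne
        rw [pathClass_smul_comm]
        by_cases ha : a' = a
        swap
        · rw [pathClass_smul_of_ne h.unit _ ha, smul_zero, smul_zero]
        subst ha
        by_cases hc : c = c'
        swap
        · rw [pathClass_smul_smul_of_ne _ _ _ hc, smul_zero]
        subst hc
        rw [pathClass_smul_smul]
        by_cases hq : IsRightSubpath (q.comp r) p
        swap
        · rw [h.kill _ _ hq, smul_zero]
        -- If `rq` is an initial segment of `p = rv`, then `q` is not longer than `v`, and for equal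
        -- length the two coincide.
        have hql := hq.length_le
        rw [hr, Path.length_comp, Path.length_comp] at hql
        have hqp := (isRightSubpath_comp q r).trans hq
        have hlt : q.length < v.length := by
          refine lt_of_le_of_ne (by omega) fun heq => hne ?_
          rw [(hqp.of_length_le ⟨r, hr⟩ heq.le).eq_of_length_le heq.ge]
        have h2 : PathAlgebra.pathBasis.repr z ⟨a', c, q⟩ = 0 := ih _ hlt c q hqp rfl
        rw [h2, zero_smul]
      · intro hns
        rw [Finsupp.notMem_support_iff.1 hns, zero_smul, smul_zero]
  · intro hz
    rw [mk_smul_eq_sum, Finsupp.sum]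
    refine Finset.sum_eq_zero ?_
    rintro ⟨a', c, q⟩ -
    by_cases ha : a' = a
    swap
    · rw [pathClass_smul_of_ne h.unit _ ha, smul_zero]
    subst ha
    by_cases hq : IsRightSubpath q p
    · have h2 : PathAlgebra.pathBasis.repr z ⟨a', c, q⟩ = 0 := hz c q hq
      rw [h2, zero_smul]
    · rw [h.kill _ _ hq, smul_zero]

/-- A module with a standard generator is determined by the path. -/
theorem IsStandard.nonempty_linearEquiv {U' : Type*} [AddCommGroup U']
    [Module (BoundAlgebra I) U'] [Module K U'] [IsScalarTower K (BoundAlgebra I) U'] {x' : U'}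
    (h : IsStandard I p x) (h' : IsStandard I p x') :
    Nonempty (U ≃ₗ[BoundAlgebra I] U') := by
  have hs := LinearMap.range_eq_top.1 ((LinearMap.range_toSpanSingleton x).trans h.span_eq)
  have hs' := LinearMap.range_eq_top.1 ((LinearMap.range_toSpanSingleton x').trans h'.span_eq)
  have hk : LinearMap.ker (LinearMap.toSpanSingleton (BoundAlgebra I) U x) =
      LinearMap.ker (LinearMap.toSpanSingleton (BoundAlgebra I) U' x') := by
    ext r
    obtain ⟨z, rfl⟩ := mk_surjective I r
    rw [LinearMap.mem_ker, LinearMap.mem_ker, LinearMap.toSpanSingleton_apply,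
      LinearMap.toSpanSingleton_apply, h.mk_smul_eq_zero_iff, h'.mk_smul_eq_zero_iff]
  exact ⟨((LinearMap.quotKerEquivOfSurjective _ hs).symm.trans
    (Submodule.quotEquivOfEq _ _ hk)).trans (LinearMap.quotKerEquivOfSurjective _ hs')⟩

/-- The layers of the radical filtration have standard generators. -/
theorem IsAdapted.isStandard_layer (h : IsAdapted I p x) {c : V} {v : Path a c}
    (hv : IsRightSubpath v p) :
    IsStandard I (Path.nil : Path c c)
      (Submodule.Quotient.mk ⟨pathClass I v • x, pathClass_smul_mem_rad v x le_rfl⟩ :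
        rad I U v.length ⧸ (rad I U (v.length + 1)).submoduleOf (rad I U v.length)) := by
  have hunit : pathClass I (Path.nil : Path c c) • pathClass I v • x = pathClass I v • x := by
    rw [pathClass_smul_smul, Path.comp_nil]
  refine ⟨?_, ?_, ?_, fun d q hq => ?_⟩
  · rw [← Submodule.Quotient.mk_smul]
    exact congrArg _ (Subtype.ext hunit)
  · rw [← Submodule.Quotient.mk_smul, Ne, Submodule.Quotient.mk_eq_zero, Submodule.submoduleOf,
      Submodule.mem_comap]
    change pathClass I (Path.nil : Path c c) • pathClass I v • x ∉ _
    rw [hunit]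
    exact h.notMem_rad hv
  · rw [eq_top_iff]
    rintro y -
    obtain ⟨⟨z, hz⟩, rfl⟩ := Submodule.Quotient.mk_surjective _ y
    obtain ⟨k, hk⟩ := h.layer c v hv z hz
    refine Submodule.mem_span_singleton.2 ⟨algebraMap K (BoundAlgebra I) k, ?_⟩
    rw [← Submodule.Quotient.mk_smul, eq_comm, Submodule.Quotient.eq, Submodule.submoduleOf,
      Submodule.mem_comap]
    change z - algebraMap K (BoundAlgebra I) k • pathClass I v • x ∈ _
    rwa [algebraMap_smul]
  · rw [← Submodule.Quotient.mk_smul, Submodule.Quotient.mk_eq_zero, Submodule.submoduleOf,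
      Submodule.mem_comap]
    refine pathClass_smul_rad (K := K) (n := v.length) q ?_ (pathClass_smul_mem_rad v x le_rfl)
    have : q.length ≠ 0 := fun h0 => hq (by
      obtain rfl := Path.eq_of_length_zero q h0
      rw [Path.eq_nil_of_length_zero q h0]
      exact isRightSubpath_refl _)
    omega

/-- The leading term of `αux` is a multiple of `tx` with `t` the initial segment of `p` of length
`m` more than that of `αu`. The suffix condition for `t` writes `t = αuw`, so the leading term can
be cancelled by changing `x` into `x - k wx`. -/
theorem SufCondition.exists_suffix (hsuf : SufCondition I) (h : IsAdapted I p x) {m : ℕ}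
    {c d : V} {u : Path a c} {α : c ⟶ d} (hu : IsRightSubpath u p)
    (hα : ¬ IsRightSubpath (u.cons α) p)
    (hm : pathClass I (u.cons α) • x ∈ rad I U ((u.cons α).length + m))
    (hm' : pathClass I (u.cons α) • x ∉ rad I U ((u.cons α).length + (m + 1))) :
    ∃ w : Path a a, w.length = m ∧ IsRightSubpath (w.comp (u.cons α)) p ∧
      ∃ k : K, pathClass I (u.cons α) • x - k • pathClass I (w.comp (u.cons α)) • x ∈
        rad I U ((u.cons α).length + (m + 1)) := by
  have hj : (u.cons α).length + m ≤ p.length := by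
    by_contra! hj
    have := rad_antitone (I := I) (U := U) (show p.length + 1 ≤ (u.cons α).length + m by omega) hm
    rw [h.rad_eq_bot, Submodule.mem_bot] at this
    rw [this] at hm'
    exact hm' (Submodule.zero_mem _)
  obtain ⟨d', t, ht, htl⟩ := exists_isRightSubpath_length p hj
  obtain ⟨k, hk⟩ := h.layer d' t ht _ (by rw [htl]; exact hm)
  rw [htl] at hk
  -- The vertex `d` fixes `αux` but would kill `tx`, leaving `αux` in the next layer.
  obtain rfl : d' = d := by
    by_contra hne
    have := Submodule.smul_mem _ (pathClass I (Path.nil : Path d d)) hk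
    rw [smul_sub, pathClass_smul_comm, pathClass_smul_smul,
      pathClass_smul_smul_of_ne _ _ _ (Ne.symm hne), smul_zero, sub_zero, Path.comp_nil] at this
    exact hm' this
  have ht0 : pathClass I t • x ≠ 0 := fun h0 => h.notMem_rad ht (by
    rw [h0]; exact Submodule.zero_mem _)
  have hu0 : pathClass I (u.cons α) • x ≠ 0 := fun h0 => hm' (by
    rw [h0]; exact Submodule.zero_mem _)
  rw [Path.length_cons] at htl
  obtain ⟨w, hw⟩ := hsuf t u α (hu.of_length_le ht (by omega)) (by omega)
    (fun h' => hα (h'.trans ht)) (.of_smul_ne_zero ht0) (.of_smul_ne_zero hu0)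
  rw [← Path.comp_cons] at hw
  subst hw
  refine ⟨w, ?_, ht, k, hk⟩
  rw [Path.length_comp, Path.length_cons] at htl
  omega

/-- Successive approximation: one substitution `x - k wx` gains a layer for all paths that leave
`p`. One suffices because `w` is the initial segment of `p` of length `m` for every arrow that needs
a correction, and at most one path `αu` leaving `p` continues this `w` inside `p`. -/
theorem SufCondition.exists_mem_rad (hadm : IsAdmissible I) (hsuf : SufCondition I)
    (h : IsAdapted I p x) (m : ℕ) :
    ∃ x : U, IsAdapted I p x ∧ ∀ (c : V) (q : Path a c), ¬ IsRightSubpath q p →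
      pathClass I q • x ∈ rad I U (q.length + m) := by
  have hU := h.isUniserial.2.2
  induction m with
  | zero => exact ⟨x, h, fun c q _ => pathClass_smul_mem_rad q x (by omega)⟩
  | succ m ih =>
    obtain ⟨x, h, hx⟩ := ih
    suffices hs : ∃ x : U, IsAdapted I p x ∧ ∀ (c d : V) (u : Path a c) (α : c ⟶ d),
        IsRightSubpath u p → ¬ IsRightSubpath (u.cons α) p →
          pathClass I (u.cons α) • x ∈ rad I U ((u.cons α).length + (m + 1)) by
      obtain ⟨x, h, hx⟩ := hs
      refine ⟨x, h, fun c q hq => ?_⟩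
      obtain ⟨d, e, s, β, r, rfl, hs, hs'⟩ := exists_break p q hq
      rw [← pathClass_smul_smul]
      exact pathClass_smul_rad (K := K) r (by rw [Path.length_comp]; omega) (hx _ _ s β hs hs')
    by_cases hall : ∀ (c d : V) (u : Path a c) (α : c ⟶ d),
        IsRightSubpath u p → ¬ IsRightSubpath (u.cons α) p →
          pathClass I (u.cons α) • x ∈ rad I U ((u.cons α).length + (m + 1))
    · exact ⟨x, h, hall⟩
    push Not at hall
    obtain ⟨c₀, d₀, u₀, α₀, hu₀, hα₀, hx₀⟩ := hall
    obtain ⟨w, hwl, hw, k, hk⟩ := hsuf.exists_suffix h hu₀ hα₀ (hx _ _ hα₀) hx₀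
    have hm : 0 < m := by
      by_contra hm
      obtain rfl := Path.eq_nil_of_length_zero w (by omega)
      exact hα₀ (by simpa using hw)
    have hunit : pathClass I (Path.nil : Path a a) • (x - k • pathClass I w • x) =
        x - k • pathClass I w • x := by
      rw [smul_sub, h.unit, pathClass_smul_comm, pathClass_smul_smul, Path.comp_nil]
    have hpx : pathClass I p • (x - k • pathClass I w • x) = pathClass I p • x := by
      have : pathClass I p • pathClass I w • x ∈ rad I U (p.length + 1) :=
        pathClass_smul_rad (K := K) (n := m) p (by omega)
          (pathClass_smul_mem_rad w x hwl.ge)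
      rw [h.rad_eq_bot, Submodule.mem_bot] at this
      rw [smul_sub, pathClass_smul_comm, this, smul_zero, sub_zero]
    refine ⟨x - k • pathClass I w • x, isAdapted_of_chain hadm hU hunit
      (by rw [hpx]; exact h.ne_zero) h.rad_eq_bot, fun c d u β hu hβ => ?_⟩
    rw [smul_sub, pathClass_smul_comm, pathClass_smul_smul]
    by_cases hwq : IsRightSubpath (w.comp (u.cons β)) p
    -- Both `βu` and `α₀u₀` continue `w` inside `p`. If one were shorter, it would be an initial
    -- segment of `u₀` or of `u`, hence of `p`; so they are equal, and `hk` is the required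
    -- statement.
    · have hlen : (u.cons β).length = (u₀.cons α₀).length := by
        rw [Path.length_cons, Path.length_cons]
        obtain hlt | heq | hlt := lt_trichotomy u.length u₀.length
        · have h1 := (hwq.of_length_le hw (by simp; omega)).of_comp_left
          exact absurd ((h1.of_length_le ⟨α₀.toPath, by simp⟩ (by simp; omega)).trans hu₀) hβ
        · omega
        · have h1 := (hw.of_length_le hwq (by simp; omega)).of_comp_left
          exact absurd ((h1.of_length_le ⟨β.toPath, by simp⟩ (by simp; omega)).trans hu) hα₀
      have h1 := (hwq.of_length_le hw
        (by rw [Path.length_comp, Path.length_comp]; omega)).of_comp_left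
      generalize u.cons β = q at *
      generalize u₀.cons α₀ = q₀ at *
      obtain rfl := h1.end_eq hlen.ge
      rw [h1.eq_of_length_le hlen.ge]
      exact hk
    · refine Submodule.sub_mem _ ?_ (Submodule.smul_of_tower_mem _ k (rad_antitone ?_ (hx _ _ hwq)))
      -- An insufficient `βux` would have a suffix `w'` of length `m`, necessarily equal to `w`,
      -- contrary to `hwq`. The term `βuwx` is deep enough because `w` has positive length.
      · by_contra hu'
        obtain ⟨w', hwl', hw', -⟩ := hsuf.exists_suffix h hu hβ (hx _ _ hβ) hu'
        obtain rfl := (((isRightSubpath_comp w' _).trans hw').of_length_le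
          ((isRightSubpath_comp w _).trans hw) (by omega)).eq_of_length_le (by omega)
        exact hwq hw'
      · rw [Path.length_comp]; omega

theorem SufCondition.exists_isStandard (hadm : IsAdmissible I) (hsuf : SufCondition I)
    (h : IsAdapted I p x) : ∃ x : U, IsStandard I p x := by
  -- At this depth the filtration is zero.
  obtain ⟨x, h, hx⟩ := hsuf.exists_mem_rad hadm h (p.length + 1)
  refine ⟨x, h.unit, h.ne_zero, h.span_eq, fun c q hq => ?_⟩
  have := rad_antitone (Nat.le_add_left _ _) (hx c q hq)
  rwa [h.rad_eq_bot, Submodule.mem_bot] at this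

end Standard

/-! ### Monomial ideals -/

section Monomial

variable {K : Type u} {V : Type v} [Field K] [Quiver.{w} V] [Finite V]
  {I : TwoSidedIdeal (PathAlgebra K V)}

variable (K V) in
theorem span_single : Submodule.span K (Set.range (PathAlgebra.single : AnyPath V →
    PathAlgebra K V)) = ⊤ := PathAlgebra.pathBasis.span_eq

theorem mul_single_mem {a b : V} (T : Submodule K (PathAlgebra K V)) (p : Path a b)
    (h : ∀ (c : V) (r : Path b c), PathAlgebra.ofPath (p.comp r) ∈ T) (x : PathAlgebra K V) :
    x * PathAlgebra.ofPath p ∈ T := by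
  have hx : x ∈ Submodule.span K (Set.range (PathAlgebra.single : AnyPath V →
    PathAlgebra K V)) := by rw [span_single K V]; trivial
  induction hx using Submodule.span_induction with
  | mem x hx =>
    obtain ⟨⟨c, d, r⟩, rfl⟩ := hx
    change PathAlgebra.ofPath r * PathAlgebra.ofPath p ∈ T
    by_cases hc : c = b
    · subst hc
      rw [PathAlgebra.ofPath_mul_ofPath]
      exact h _ _
    · rw [PathAlgebra.ofPath_mul_ofPath_of_ne _ _ hc]
      exact T.zero_mem
  | zero => rw [zero_mul]; exact T.zero_mem
  | add x y _ _ hx hy => rw [add_mul]; exact T.add_mem hx hy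
  | smul c x _ hx => rw [smul_mul_assoc]; exact T.smul_mem c hx

theorem single_mul_mem {a b : V} (T : Submodule K (PathAlgebra K V)) (p : Path a b)
    (h : ∀ (c : V) (r : Path c a), PathAlgebra.ofPath (r.comp p) ∈ T) (x : PathAlgebra K V) :
    PathAlgebra.ofPath p * x ∈ T := by
  have hx : x ∈ Submodule.span K (Set.range (PathAlgebra.single : AnyPath V →
    PathAlgebra K V)) := by rw [span_single K V]; trivial
  induction hx using Submodule.span_induction with
  | mem x hx =>
    obtain ⟨⟨c, d, r⟩, rfl⟩ := hx
    change PathAlgebra.ofPath p * PathAlgebra.ofPath r ∈ T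
    by_cases hc : a = d
    · subst hc
      rw [PathAlgebra.ofPath_mul_ofPath]
      exact h _ _
    · rw [PathAlgebra.ofPath_mul_ofPath_of_ne _ _ hc]
      exact T.zero_mem
  | zero => rw [mul_zero]; exact T.zero_mem
  | add x y _ _ hx hy => rw [mul_add]; exact T.add_mem hx hy
  | smul c x _ hx => rw [mul_smul_comm]; exact T.smul_mem c hx

/-- A monomial ideal is the linear span of its paths. -/
theorem IsMonomial.mem_span (h : IsMonomial I) {z : PathAlgebra K V} (hz : z ∈ I) :
    z ∈ Submodule.span K {y : PathAlgebra K V | ∃ (a b : V) (p : Path a b),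
      PathAlgebra.ofPath p ∈ I ∧ y = PathAlgebra.ofPath p} := by
  set T := Submodule.span K {y : PathAlgebra K V | ∃ (a b : V) (p : Path a b),
    PathAlgebra.ofPath p ∈ I ∧ y = PathAlgebra.ofPath p} with hT
  -- The span `T` of the paths in `I` is itself a two-sided ideal, and it contains the generators of
  -- `I`.
  let J : TwoSidedIdeal (PathAlgebra K V) := TwoSidedIdeal.mk' (T : Set (PathAlgebra K V))
    T.zero_mem T.add_mem T.neg_mem
    (fun {x y} hy => by
      rw [SetLike.mem_coe] at *
      induction hy using Submodule.span_induction with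
      | mem y hy =>
        obtain ⟨a, b, p, hp, rfl⟩ := hy
        refine mul_single_mem T p (fun c r => Submodule.subset_span ⟨_, _, _, ?_, rfl⟩) x
        rw [← PathAlgebra.ofPath_mul_ofPath]
        exact I.mul_mem_left _ _ hp
      | zero => rw [mul_zero]; exact T.zero_mem
      | add y y' _ _ hx hy => rw [mul_add]; exact T.add_mem hx hy
      | smul c y _ hx => rw [mul_smul_comm]; exact T.smul_mem c hx)
    (fun {y x} hy => by
      rw [SetLike.mem_coe] at *
      induction hy using Submodule.span_induction with
      | mem y hy =>
        obtain ⟨a, b, p, hp, rfl⟩ := hy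
        refine single_mul_mem T p (fun c r => Submodule.subset_span ⟨_, _, _, ?_, rfl⟩) x
        rw [← PathAlgebra.ofPath_mul_ofPath]
        exact I.mul_mem_right _ _ hp
      | zero => rw [zero_mul]; exact T.zero_mem
      | add y y' _ _ hx hy => rw [add_mul]; exact T.add_mem hx hy
      | smul c y _ hx => rw [smul_mul_assoc]; exact T.smul_mem c hx)
  have hJ : I ≤ J := by
    obtain ⟨S, hS⟩ := h
    rw [hS, TwoSidedIdeal.span_le]
    rintro _ ⟨⟨a, b, p⟩, hp, rfl⟩
    change PathAlgebra.ofPath p ∈ TwoSidedIdeal.mk' _ _ _ _ _ _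
    rw [TwoSidedIdeal.mem_mk']
    refine Submodule.subset_span ⟨a, b, p, ?_, rfl⟩
    rw [hS]
    exact TwoSidedIdeal.subset_span ⟨_, hp, rfl⟩
  have := hJ hz
  rwa [TwoSidedIdeal.mem_mk'] at this

/-- Consequently the coefficient at a nonzero path is a well-defined functional on `Λ`; this is
where monomiality enters the construction of the family. -/
theorem IsMonomial.coeff_eq_zero (h : IsMonomial I) {z : PathAlgebra K V} (hz : z ∈ I) {a b : V}
    {p : Path a b} (hp : NonzeroPath I p) : z.coeff ⟨a, b, p⟩ = 0 := by
  have hz' := h.mem_span hz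
  clear hz
  induction hz' using Submodule.span_induction with
  | mem z hz =>
    obtain ⟨c, d, q, hq, rfl⟩ := hz
    refine coeff_single_of_ne fun h => hp ?_
    change PathAlgebra.single _ ∈ I at hq
    rwa [h] at hq
  | zero => simp [PathAlgebra.coeff]
  | add x y _ _ hx hy => simp_all [PathAlgebra.coeff]
  | smul c x _ hx => simp_all [PathAlgebra.coeff]

end Monomial

/-! ### A family of uniserial modules -/

section Family

variable {K : Type u} {V : Type v} [Field K] [Quiver.{w} V] [Finite V]

/-- The left ideal of the elements `r` of `KΓ / I` such that `f` vanishes on the left ideal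
generated by (a representative of) `r`. -/
def annihilatorIdeal (I : TwoSidedIdeal (PathAlgebra K V)) (f : PathAlgebra K V →ₗ[K] K) :
    Submodule (BoundAlgebra I) (BoundAlgebra I) where
  carrier := {r | ∃ z, I.ringCon.mk' z = r ∧ ∀ y, f (y * z) = 0}
  zero_mem' := ⟨0, by simp, by simp⟩
  add_mem' := by
    rintro _ _ ⟨z, rfl, hz⟩ ⟨z', rfl, hz'⟩
    exact ⟨z + z', by simp, fun y => by rw [mul_add, map_add, hz, hz', add_zero]⟩
  smul_mem' := by
    rintro r _ ⟨z, rfl, hz⟩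
    obtain ⟨y, rfl⟩ := mk_surjective I r
    exact ⟨y * z, by simp, fun y' => by rw [← mul_assoc, hz]⟩

variable {I : TwoSidedIdeal (PathAlgebra K V)} {f : PathAlgebra K V →ₗ[K] K}

theorem mk_mem_annihilatorIdeal (hf : ∀ z ∈ I, f z = 0) {z : PathAlgebra K V} :
    I.ringCon.mk' z ∈ annihilatorIdeal I f ↔
      ∀ (c d : V) (r : Path c d), f (PathAlgebra.ofPath r * z) = 0 := by
  constructor
  · rintro ⟨z', hz', h⟩ c d r
    have h1 : z - z' ∈ I := by rw [← mk_eq_zero, map_sub, hz', sub_self]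
    have h2 := hf _ (I.mul_mem_left (PathAlgebra.ofPath r) _ h1)
    rwa [mul_sub, map_sub, h, sub_zero] at h2
  · refine fun h => ⟨z, rfl, fun y => ?_⟩
    have key : f.comp (PathAlgebra.mulLin.flip z) = 0 :=
      PathAlgebra.hom_ext fun r => h r.1 r.2.1 r.2.2
    exact congrArg (fun g => g y) key

/-- The functional that picks the coefficient of `p` plus `κ` times that of `q`. -/
def twoPathFunctional (p q : AnyPath V) (κ : K) : PathAlgebra K V →ₗ[K] K :=
  PathAlgebra.pathBasis.coord p + κ • PathAlgebra.pathBasis.coord q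

theorem twoPathFunctional_apply (p q : AnyPath V) (κ : K) (z : PathAlgebra K V) :
    twoPathFunctional p q κ z = z.coeff p + κ * z.coeff q := rfl

variable (I) in
/-- The uniserial module with mast `p` and generator `x` in which `α u x = κ p x`. -/
abbrev familyModule {a b c : V} (p : Path a b) (u : Path a c) (α : c ⟶ b) (κ : K) :=
  BoundAlgebra I ⧸ annihilatorIdeal I (twoPathFunctional ⟨a, b, p⟩ ⟨a, b, u.cons α⟩ κ)

variable (I) in
/-- The generator of `familyModule`. -/
def familyGenerator {a b c : V} (p : Path a b) (u : Path a c) (α : c ⟶ b) (κ : K) :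
    familyModule I p u α κ :=
  Submodule.Quotient.mk (pathClass I (Path.nil : Path a a))

variable {a b c : V} {p : Path a b} {u : Path a c} {α : c ⟶ b} {κ : K}

theorem pathClass_smul_familyGenerator {d : V} (q : Path a d) :
    pathClass I q • familyGenerator I p u α κ = Submodule.Quotient.mk (pathClass I q) := by
  rw [familyGenerator, ← Submodule.Quotient.mk_smul, smul_eq_mul, pathClass_mul, Path.nil_comp]

theorem twoPathFunctional_eq_zero (hmon : IsMonomial I) (hp : NonzeroPath I p)
    (hq : NonzeroPath I (u.cons α)) (z : PathAlgebra K V) (hz : z ∈ I) :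
    twoPathFunctional ⟨a, b, p⟩ ⟨a, b, u.cons α⟩ κ z = 0 := by
  rw [twoPathFunctional_apply, hmon.coeff_eq_zero hz hp, hmon.coeff_eq_zero hz hq, mul_zero,
    add_zero]

theorem twoPathFunctional_self (hα : ¬ IsRightSubpath (u.cons α) p) :
    twoPathFunctional ⟨a, b, p⟩ ⟨a, b, u.cons α⟩ κ (PathAlgebra.ofPath p) = 1 := by
  rw [twoPathFunctional_apply, PathAlgebra.ofPath, coeff_single_self, coeff_single_of_ne,
    mul_zero, add_zero]
  exact fun h => hα (isRightSubpath_of_mk_eq h.symm)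

/-- No multiple `rq` equals `p` or `αu`: the proper initial segments of `αu` are initial segments of
`u`, hence of `p`. -/
theorem pathClass_smul_familyGenerator_eq_zero (hmon : IsMonomial I) (hp : NonzeroPath I p)
    (hq : NonzeroPath I (u.cons α)) (hu : IsRightSubpath u p) {d : V} {q : Path a d}
    (hqp : ¬ IsRightSubpath q p) (hqα : (⟨a, d, q⟩ : AnyPath V) ≠ ⟨a, b, u.cons α⟩) :
    pathClass I q • familyGenerator I p u α κ = 0 := by
  rw [pathClass_smul_familyGenerator, Submodule.Quotient.mk_eq_zero, pathClass,
    mk_mem_annihilatorIdeal (twoPathFunctional_eq_zero hmon hp hq)]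
  intro e e' r
  by_cases he : e = d
  swap
  · rw [PathAlgebra.ofPath_mul_ofPath_of_ne _ _ he, map_zero]
  subst he
  rw [PathAlgebra.ofPath_mul_ofPath, twoPathFunctional_apply, PathAlgebra.ofPath,
    coeff_single_of_ne, coeff_single_of_ne, mul_zero, add_zero]
  · intro h
    cases r with
    | nil => exact hqα h
    | cons r β =>
      have h1 := isRightSubpath_of_mk_eq h
      have h2 := length_eq_of_mk_eq h
      simp only [Path.comp_cons, Path.length_cons, add_left_inj] at h1 h2
      have h3 : IsRightSubpath (q.comp r) (u.cons α) :=
        IsRightSubpath.trans ⟨β.toPath, by simp⟩ h1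
      have h4 : IsRightSubpath (q.comp r) u := h3.of_length_le ⟨α.toPath, by simp⟩ h2.le
      exact hqp (((isRightSubpath_comp q r).trans h4).trans hu)
  · exact fun h => hqp ((isRightSubpath_comp q r).trans (isRightSubpath_of_mk_eq h))

/-- The functional takes the values `κ` on `αu` and `1` on `p`, and vanishes on all their proper
prolongations, since `αu` is not an initial segment of `p` and is not longer than `p`. -/
theorem pathClass_cons_smul_familyGenerator (hmon : IsMonomial I) (hp : NonzeroPath I p)
    (hq : NonzeroPath I (u.cons α)) (hul : u.length < p.length)
    (hα : ¬ IsRightSubpath (u.cons α) p) :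
    pathClass I (u.cons α) • familyGenerator I p u α κ =
      κ • pathClass I p • familyGenerator I p u α κ := by
  rw [pathClass_smul_familyGenerator, pathClass_smul_familyGenerator, ← Submodule.Quotient.mk_smul,
    Submodule.Quotient.eq, pathClass, pathClass, ← mk_smul, ← map_sub,
    mk_mem_annihilatorIdeal (twoPathFunctional_eq_zero hmon hp hq)]
  intro e e' r
  by_cases he : e = b
  swap
  · rw [mul_sub, mul_smul_comm, PathAlgebra.ofPath_mul_ofPath_of_ne _ _ he,
      PathAlgebra.ofPath_mul_ofPath_of_ne _ _ he, smul_zero, sub_zero, map_zero]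
  subst he
  rw [mul_sub, mul_smul_comm, PathAlgebra.ofPath_mul_ofPath, PathAlgebra.ofPath_mul_ofPath,
    map_sub, map_smul]
  by_cases hr : r.length = 0
  · obtain rfl := Path.eq_of_length_zero r hr
    rw [Path.eq_nil_of_length_zero r hr, Path.comp_nil, Path.comp_nil, twoPathFunctional_self hα,
      twoPathFunctional_apply, PathAlgebra.ofPath, coeff_single_self, coeff_single_of_ne]
    · simp
    · exact fun h => hα (isRightSubpath_of_mk_eq h)
  · rw [twoPathFunctional_apply, twoPathFunctional_apply, PathAlgebra.ofPath, PathAlgebra.ofPath,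
      coeff_single_of_ne, coeff_single_of_ne, coeff_single_of_ne, coeff_single_of_ne]
    · simp
    all_goals
      intro h
      have h1 := length_eq_of_mk_eq h
      simp only [Path.length_comp, Path.length_cons] at h1
      first
      | omega
      | exact hα ((isRightSubpath_comp _ r).trans (isRightSubpath_of_mk_eq h))

theorem isAdapted_familyGenerator (hmon : IsMonomial I) (hp : NonzeroPath I p)
    (hq : NonzeroPath I (u.cons α)) (hu : IsRightSubpath u p) (hul : u.length < p.length)
    (hα : ¬ IsRightSubpath (u.cons α) p) : IsAdapted I p (familyGenerator I p u α κ) := by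
  have hf := twoPathFunctional_eq_zero (κ := κ) hmon hp hq
  have hunit : pathClass I (Path.nil : Path a a) • familyGenerator I p u α κ =
      familyGenerator I p u α κ := by
    rw [pathClass_smul_familyGenerator, familyGenerator]
  have hspan : Submodule.span (BoundAlgebra I) {familyGenerator I p u α κ} = ⊤ := by
    rw [eq_top_iff]
    rintro y -
    obtain ⟨r, rfl⟩ := Submodule.Quotient.mk_surjective _ y
    refine Submodule.mem_span_singleton.2 ⟨r, ?_⟩
    rw [familyGenerator, ← Submodule.Quotient.mk_smul, Submodule.Quotient.eq, smul_eq_mul]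
    obtain ⟨z, rfl⟩ := mk_surjective I r
    -- The classes of `z` and `z e_a` agree because the functional only sees paths that start at
    -- `a`.
    refine ⟨z * PathAlgebra.ofPath Path.nil - z, by rw [map_sub, map_mul]; rfl, fun y => ?_⟩
    rw [mul_sub, ← mul_assoc]
    generalize y * z = t
    let W : Submodule K (PathAlgebra K V) :=
      LinearMap.ker ((twoPathFunctional ⟨a, b, p⟩ ⟨a, b, u.cons α⟩ κ).comp
        (PathAlgebra.mulLin.flip (PathAlgebra.ofPath (Path.nil : Path a a)) - LinearMap.id))
    change t ∈ W
    have ht : t ∈ Submodule.span K (Set.range (PathAlgebra.single : AnyPath V →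
      PathAlgebra K V)) := by rw [span_single K V]; trivial
    refine (Submodule.span_le.2 ?_ : _ ≤ W) ht
    rintro _ ⟨⟨d, e, r⟩, rfl⟩
    change twoPathFunctional _ _ κ (PathAlgebra.ofPath r * PathAlgebra.ofPath Path.nil -
      PathAlgebra.ofPath r) = 0
    by_cases hd : d = a
    · subst hd
      rw [PathAlgebra.ofPath_mul_ofPath, Path.nil_comp, sub_self, map_zero]
    · rw [PathAlgebra.ofPath_mul_ofPath_of_ne _ _ hd, zero_sub, map_neg, twoPathFunctional_apply,
        PathAlgebra.ofPath, coeff_single_of_ne, coeff_single_of_ne, mul_zero, add_zero, neg_zero]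
      · exact fun h => hd (congrArg Sigma.fst h)
      · exact fun h => hd (congrArg Sigma.fst h)
  refine ⟨hunit, ?_, hspan, ?_, fun d t ht z hz => ?_⟩
  · rw [pathClass_smul_familyGenerator, Ne, Submodule.Quotient.mk_eq_zero, pathClass,
      mk_mem_annihilatorIdeal hf]
    intro h
    have := h b b Path.nil
    rw [PathAlgebra.ofPath_mul_ofPath, Path.comp_nil, twoPathFunctional_self hα] at this
    exact one_ne_zero this
  · rw [eq_bot_iff]
    intro z hz
    refine rad_le_of_generator (K := K) ⊥ (p.length + 1) hunit hspan (fun d q hql => ?_) z hz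
    rw [Submodule.mem_bot]
    refine pathClass_smul_familyGenerator_eq_zero hmon hp hq hu (fun h => ?_) (fun h => ?_)
    · have := h.length_le
      omega
    · have := length_eq_of_mk_eq h
      rw [Path.length_cons] at this
      omega
  · rw [← mem_lineAddRad]
    refine rad_le_of_generator _ t.length hunit hspan (fun e q hql => ?_) z hz
    rw [mem_lineAddRad]
    obtain hlt | heq := hql.lt_or_eq
    · refine ⟨0, ?_⟩
      rw [zero_smul, sub_zero]
      exact pathClass_smul_mem_rad _ _ hlt
    by_cases hqp : IsRightSubpath q p
    · have h1 := ht.of_length_le hqp heq.le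
      obtain rfl := h1.end_eq heq.ge
      refine ⟨1, ?_⟩
      rw [h1.eq_of_length_le heq.ge, one_smul, sub_self]
      exact Submodule.zero_mem _
    -- Here `αux = κ px` lies in the bottom layer: it is a multiple of `tx` if `t = p`, and belongs
    -- to a deeper layer otherwise.
    by_cases hqα : (⟨a, e, q⟩ : AnyPath V) = ⟨a, b, u.cons α⟩
    · cases hqα
      rw [pathClass_cons_smul_familyGenerator hmon hp hq hul hα]
      obtain hlt | heq' := ht.length_le.lt_or_eq
      · refine ⟨0, ?_⟩
        rw [zero_smul, sub_zero]
        exact Submodule.smul_of_tower_mem _ κ (pathClass_smul_mem_rad _ _ hlt)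
      · obtain rfl := ht.end_eq heq'.ge
        refine ⟨κ, ?_⟩
        rw [ht.eq_of_length_le heq'.ge, sub_self]
        exact Submodule.zero_mem _
    · refine ⟨0, ?_⟩
      rw [pathClass_smul_familyGenerator_eq_zero hmon hp hq hu hqp hqα, zero_smul, sub_zero]
      exact Submodule.zero_mem _

/-- If `p` does not end in `α u`, the modules of the family are pairwise nonisomorphic. -/
theorem familyModule_injective (hmon : IsMonomial I) (hp : NonzeroPath I p)
    (hq : NonzeroPath I (u.cons α)) (hu : IsRightSubpath u p) (hul : u.length < p.length)
    (hα : ¬ IsRightSubpath (u.cons α) p) (hw : ¬ ∃ w : Path a a, p = (w.comp u).cons α)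
    {κ κ' : K} (φ : familyModule I p u α κ ≃ₗ[BoundAlgebra I] familyModule I p u α κ') :
    κ = κ' := by
  have hx := isAdapted_familyGenerator (κ := κ) hmon hp hq hu hul hα
  have hx' := isAdapted_familyGenerator (κ := κ') hmon hp hq hu hul hα
  have hf := twoPathFunctional_eq_zero (κ := κ') hmon hp hq
  have hrel := pathClass_cons_smul_familyGenerator (κ := κ) hmon hp hq hul hα
  have hrel' := pathClass_cons_smul_familyGenerator (κ := κ') hmon hp hq hul hα
  set x := familyGenerator I p u α κ
  set x' := familyGenerator I p u α κ' with hx'def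
  obtain ⟨r, hr⟩ := Submodule.mem_span_singleton.1
    (show φ x ∈ Submodule.span (BoundAlgebra I) {x'} by rw [hx'.span_eq]; trivial)
  obtain ⟨k, hk⟩ := exists_smul_sub_mem_rad (K := K) (n := 0) hx'.unit
    (by rw [rad_zero]; trivial) r
  rw [hr] at hk
  -- An isomorphism sends `x` to `kx' + y` with `y` in the radical. Comparing the two relations
  -- gives `αuy = (κ - κ')k px'`; the rest of the proof shows that `αuy` has no `px'` component.
  set y := φ x - k • x' with hy
  have hφx : φ x = k • x' + y := by rw [hy]; abel
  have hpy : pathClass I p • y = 0 := by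
    have := pathClass_smul_rad (K := K) (m := p.length + 1) p (by omega) hk
    rwa [hx'.rad_eq_bot, Submodule.mem_bot] at this
  have hpφ : pathClass I p • φ x = k • pathClass I p • x' := by
    rw [hφx, smul_add, hpy, add_zero, pathClass_smul_comm]
  have hk0 : k ≠ 0 := by
    rintro rfl
    rw [zero_smul, ← map_smul] at hpφ
    exact hx.ne_zero (φ.map_eq_zero_iff.1 hpφ)
  have hφrel : pathClass I (u.cons α) • φ x = κ • pathClass I p • φ x := by
    rw [← map_smul, hrel, ← map_smul, ← algebraMap_smul (BoundAlgebra I) κ, map_smul,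
      algebraMap_smul]
  have hαy : pathClass I (u.cons α) • y = ((κ - κ') * k) • pathClass I p • x' := by
    rw [hpφ, hφx, smul_add, pathClass_smul_comm, hrel'] at hφrel
    rw [← sub_eq_iff_eq_add'.2 hφrel.symm, smul_smul, smul_smul, ← sub_smul]
    congr 1
    ring
  -- `W` consists of the elements whose image under `αu` has a representative on which the
  -- functional, after multiplication by `e_b`, vanishes. For `qx'` with `q` of positive length,
  -- `αuq` is such a representative: it differs from `αu` by length and from `p` because `p` does
  -- not end in `αu`.
  let W : Submodule K (familyModule I p u α κ') :=
    { carrier := {y | ∃ z, twoPathFunctional ⟨a, b, p⟩ ⟨a, b, u.cons α⟩ κ'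
        (PathAlgebra.ofPath (Path.nil : Path b b) * z) = 0 ∧
        pathClass I (u.cons α) • y = Submodule.Quotient.mk (I.ringCon.mk' z)}
      zero_mem' := ⟨0, by simp, by simp⟩
      add_mem' := by
        rintro y y' ⟨z, hz, hy⟩ ⟨z', hz', hy'⟩
        exact ⟨z + z', by rw [mul_add, map_add, hz, hz', add_zero], by
          rw [smul_add, hy, hy', map_add, Submodule.Quotient.mk_add]⟩
      smul_mem' := by
        rintro c y ⟨z, hz, hy⟩
        exact ⟨c • z, by rw [mul_smul_comm, map_smul, hz, smul_zero], by
          rw [pathClass_smul_comm, hy, mk_smul, Submodule.Quotient.mk_smul]⟩ }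
  obtain ⟨z, hz, hyz⟩ : y ∈ W := by
    refine rad_le_of_generator W 1 hx'.unit hx'.span_eq (fun d q hql => ?_) y hk
    by_cases hd : a = d
    swap
    · exact ⟨0, by simp, by rw [pathClass_smul_smul_of_ne _ _ _ hd]; simp⟩
    subst hd
    refine ⟨PathAlgebra.ofPath (q.comp (u.cons α)), ?_, by
      rw [pathClass_smul_smul, pathClass_smul_familyGenerator]; rfl⟩
    rw [PathAlgebra.ofPath_mul_ofPath, Path.comp_nil, twoPathFunctional_apply, PathAlgebra.ofPath,
      coeff_single_of_ne, coeff_single_of_ne, mul_zero, add_zero]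
    · intro h
      have := length_eq_of_mk_eq h
      rw [Path.length_comp] at this
      omega
    · intro h
      have h1 := isRightSubpath_of_mk_eq h
      have h2 := length_eq_of_mk_eq h
      exact hw ⟨q, by rw [← Path.comp_cons, h1.eq_of_length_le h2.ge]⟩
  rw [hαy, hx'def, pathClass_smul_familyGenerator, ← Submodule.Quotient.mk_smul, eq_comm,
    Submodule.Quotient.eq, pathClass, ← mk_smul, ← map_sub, mk_mem_annihilatorIdeal hf] at hyz
  have h0 := hyz b b Path.nil
  rw [mul_sub, map_sub, hz, mul_smul_comm, PathAlgebra.ofPath_mul_ofPath, Path.comp_nil, map_smul,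
    twoPathFunctional_self hα, zero_sub, neg_eq_zero, smul_eq_mul, mul_one] at h0
  exact sub_eq_zero.1 ((mul_eq_zero.1 h0).resolve_right hk0)

end Family

/-! ### Slack variables -/

section Slack

variable {K : Type u} {V : Type v} [Field K] [Quiver.{w} V] [Finite V]
  {I : TwoSidedIdeal (PathAlgebra K V)}

variable (I) in
/-- Every module over `KΓ / I` is a vector space over `K`. -/
abbrev moduleOfBoundAlgebra (U : Type*) [AddCommGroup U] [Module (BoundAlgebra I) U] :
    Module K U := Module.compHom U (algebraMap K (BoundAlgebra I))

theorem isScalarTower_moduleOfBoundAlgebra (U : Type*) [AddCommGroup U]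
    [Module (BoundAlgebra I) U] :
    letI := moduleOfBoundAlgebra I U
    IsScalarTower K (BoundAlgebra I) U :=
  letI := moduleOfBoundAlgebra I U
  ⟨fun c r y => by
    change (c • r) • y = algebraMap K (BoundAlgebra I) c • r • y
    rw [Algebra.smul_def, mul_smul]⟩

theorem IsMast.nonzeroPath {a b : V} {p : Path a b} (h : IsMast I p) : NonzeroPath I p := by
  obtain ⟨U, -, -, x, hx⟩ := h
  exact .of_smul_ne_zero hx

theorem SufCondition.conditionN (hadm : IsAdmissible I) (h : SufCondition I) : ConditionN I :=
  fun _ _ α p hl hp => h.pathConditionN hadm α p hl hp.nonzeroPath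

/-- A nonzero path that is parallel to `α` and does not start with it is a mast, by the family with
trivial `u` and `κ = 0`. -/
theorem ConditionN.pathConditionN (hadm : IsAdmissible I) (hmon : IsMonomial I)
    (h : ConditionN I) : PathConditionN I := by
  intro e e' α p hl hp
  by_cases hα : IsRightSubpath (Path.nil.cons α) p
  · exact Or.inl hα
  · exact h e e' α p hl ⟨ModuleCat.of _ (familyModule I p Path.nil α 0),
      (isAdapted_familyGenerator hmon hp (hadm.nonzeroPath (by simp)) (isRightSubpath_nil p) hl
        hα).isMastOf⟩

-- In the family module only the detour `(α, u)` acts nontrivially on the generator, so a whole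
-- coordinate axis lies in `V_p`.
open Classical in
theorem single_mem_uniserialVariety (hmon : IsMonomial I)
    {a b c : V} {p : Path a b} {u : Path a c} {α : c ⟶ b} (hp : NonzeroPath I p)
    (hq : NonzeroPath I (u.cons α)) (hu : IsRightSubpath u p) (hul : u.length < p.length)
    (hα : ¬ IsRightSubpath (u.cons α) p) (κ : K) :
    Pi.single (⟨⟨c, b, u, α, hu, hα, p, isRightSubpath_refl p, hul⟩,
      ⟨p, isRightSubpath_refl p, hul⟩⟩ : Variable p) κ ∈ uniserialVariety I p := by
  have hx := isAdapted_familyGenerator (κ := κ) hmon hp hq hu hul hα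
  refine ⟨ModuleCat.of _ (familyModule I p u α κ), hx.isMastOf, familyGenerator I p u α κ,
    hx.isTopElement, fun D => ?_⟩
  by_cases hD : D = ⟨c, b, u, α, hu, hα, p, isRightSubpath_refl p, hul⟩
  · subst hD
    rw [finsum_eq_single _ ⟨p, isRightSubpath_refl p, hul⟩, Pi.single_eq_same]
    · rw [smul_assoc]
      exact pathClass_cons_smul_familyGenerator hmon hp hq hul hα
    · rintro t hne
      rw [Pi.single_eq_of_ne fun h => hne (eq_of_heq (Sigma.mk.inj h).2), zero_smul]
  · rw [finsum_eq_zero_of_forall_eq_zero fun i => by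
        rw [Pi.single_eq_of_ne fun h => hD (Sigma.mk.inj h).1, zero_smul], zero_smul]
    exact pathClass_smul_familyGenerator_eq_zero hmon hp hq hu D.not_right_subpath
      fun h => hD (Detour.ext_of_mk_eq h)

/-- A polynomial relation for the variable of `(α, u)` with `v_i = p` would vanish at every `κ` in
the infinite field `K`; so this variable is slack and `(Suf, p)` applies to it. -/
theorem sufCondition_of_allMastsSuf [Infinite K] (hmon : IsMonomial I) (h : AllMastsSuf I) :
    SufCondition I := by
  classical
  intro a b c p u α hu hul hα hp hq
  have hx := isAdapted_familyGenerator (κ := (0 : K)) hmon hp hq hu hul hα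
  let D : Detour p := ⟨c, b, u, α, hu, hα, p, isRightSubpath_refl p, hul⟩
  let i : D.Longer := ⟨p, isRightSubpath_refl p, hul⟩
  have htr : Transcendental K (variableImage I (⟨D, i⟩ : Variable p)) := by
    rw [transcendental_iff]
    intro g hg
    have h1 : Ideal.Quotient.mkₐ K (MvPolynomial.vanishingIdeal K (uniserialVariety I p))
        (Polynomial.aeval (MvPolynomial.X (⟨D, i⟩ : Variable p)) g) = 0 := by
      rw [← Polynomial.aeval_algHom_apply]
      exact hg
    rw [Ideal.Quotient.mkₐ_eq_mk, Ideal.Quotient.eq_zero_iff_mem] at h1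
    refine Polynomial.funext fun κ => ?_
    have h2 := h1 _ (single_mem_uniserialVariety hmon hp hq hu hul hα κ)
    rw [← Polynomial.aeval_algHom_apply, MvPolynomial.aeval_X, Pi.single_eq_same] at h2
    rw [Polynomial.eval_zero, ← Polynomial.coe_aeval_eq_eval]
    exact h2
  obtain ⟨w, -, hw⟩ := h a b p (by omega) ⟨ModuleCat.of _ _, hx.isMastOf⟩ D i
    ⟨⟨i, fun h0 => htr (by rw [h0]; exact isAlgebraic_zero)⟩, htr⟩
  exact ⟨w, hw⟩

/-- Triangularity again: multiplying by the rest of `p` after `v_i` kills the longer terms, and the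
shorter coefficients vanish by induction. -/
theorem IsAdapted.coeff_eq_zero {U : Type*} [AddCommGroup U] [Module (BoundAlgebra I) U]
    [Module K U] [IsScalarTower K (BoundAlgebra I) U] {a b : V} {p : Path a b} {x : U}
    (h : IsAdapted I p x) {D : Detour p} (k : D.Longer → K)
    (hk : (∑ᶠ i : D.Longer, k i • pathClass I i.1) • x = 0) (i : D.Longer) : k i = 0 := by
  let _ := Fintype.ofFinite D.Longer
  rw [finsum_eq_sum_of_fintype, Finset.sum_smul] at hk
  suffices hall : ∀ n, ∀ i : D.Longer, i.1.length = n → k i = 0 from hall _ i rfl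
  intro n
  induction n using Nat.strong_induction_on with
  | _ n ih =>
    rintro i rfl
    obtain ⟨r, hr⟩ := i.2.1
    have h1 := congrArg (fun y => pathClass I r • y) hk
    rw [smul_zero, Finset.smul_sum, Finset.sum_eq_single i] at h1
    · rw [smul_assoc, pathClass_smul_comm, pathClass_smul_smul, ← hr] at h1
      exact (smul_eq_zero.1 h1).resolve_right h.ne_zero
    · intro j _ hne
      obtain hlt | heq | hlt := lt_trichotomy j.1.length i.1.length
      · rw [ih _ hlt j rfl, zero_smul, zero_smul, smul_zero]
      · exact absurd (Subtype.ext ((j.2.1.of_length_le i.2.1 heq.le).eq_of_length_le heq.ge)) hne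
      · have h2 : pathClass I (j.1.comp r) • x ∈ rad I U (p.length + 1) := by
          refine pathClass_smul_mem_rad _ _ ?_
          have := congrArg Path.length hr
          rw [Path.length_comp] at this ⊢
          omega
        rw [h.rad_eq_bot, Submodule.mem_bot] at h2
        rw [smul_assoc, pathClass_smul_comm, pathClass_smul_smul, h2, smul_zero]
    · exact fun h => absurd (Finset.mem_univ i) h

/-- A slack variable is nonzero at some point of `V_p`. In a module belonging to that point `αux ≠
0`, because the `v_i x` are independent; so `αu` is a nonzero path, and the suffix condition applies
to `v_i`. -/
theorem SufCondition.allMastsSuf (hadm : IsAdmissible I) (h : SufCondition I) :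
    AllMastsSuf I := by
  rintro a b p - hp D i ⟨-, htr⟩
  obtain ⟨k, ⟨U, hU, x, hx, hk⟩, hki⟩ : ∃ k ∈ uniserialVariety I p, k ⟨D, i⟩ ≠ 0 := by
    by_contra! h0
    refine htr ?_
    rw [variableImage, Ideal.Quotient.eq_zero_iff_mem.2]
    · exact isAlgebraic_zero
    · intro k hk
      rw [MvPolynomial.aeval_X, h0 k hk]
  let _ := moduleOfBoundAlgebra I U
  have _ := isScalarTower_moduleOfBoundAlgebra (I := I) U
  have hA := hU.isAdapted hadm hx
  have hαx : pathClass I (D.u.cons D.α) • x ≠ 0 := fun h0 =>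
    hki (hA.coeff_eq_zero (fun i => k ⟨D, i⟩) (by rw [← hk D, h0]) i)
  obtain ⟨w, hw⟩ := h i.1 D.u D.α (D.right_subpath.of_length_le i.2.1 i.2.2.le) i.2.2
    (fun h' => D.not_right_subpath (h'.trans i.2.1)) (hp.nonzeroPath.of_isRightSubpath i.2.1)
    (.of_smul_ne_zero hαx)
  refine ⟨w, IsRightSubpath.trans ?_ i.2.1, hw⟩
  rw [hw, ← Path.comp_cons]
  exact isRightSubpath_comp _ _

end Slack

/-! ### Finite uniserial type and composition series -/

section Types

variable {K : Type u} {V : Type v} [Field K] [Quiver.{w} V] [Finite V]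
  {I : TwoSidedIdeal (PathAlgebra K V)}

theorem sufCondition_of_finiteUniserialType [Infinite K] (hmon : IsMonomial I)
    (h : FiniteUniserialType (BoundAlgebra I)) : SufCondition I := by
  intro a b c p u α hu hul hα hp hq
  by_contra hw
  obtain ⟨n, U, hU⟩ := h
  have hM : ∀ κ : K, ∃ i, Nonempty (familyModule I p u α κ ≃ₗ[BoundAlgebra I] U i) := fun κ =>
    hU (ModuleCat.of _ (familyModule I p u α κ))
      (isAdapted_familyGenerator hmon hp hq hu hul hα).isUniserial
  choose i hi using hM
  obtain ⟨κ, κ', hne, heq⟩ := Finite.exists_ne_map_eq_of_infinite i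
  obtain ⟨φ⟩ := hi κ
  obtain ⟨ψ⟩ := hi κ'
  rw [← heq] at ψ
  exact hne (familyModule_injective hmon hp hq hu hul hα hw (φ.trans ψ.symm))

variable {U : Type (max u v w)} [AddCommGroup U] [Module (BoundAlgebra I) U]
  [Module K U] [IsScalarTower K (BoundAlgebra I) U] {a b : V} {p : Path a b} {x : U}

variable (I U) in
/-- The `n`-th layer of the radical filtration. -/
abbrev Layer (n : ℕ) := rad I U n ⧸ (rad I U (n + 1)).submoduleOf (rad I U n)

theorem IsMastOf.exists_isAdapted (hadm : IsAdmissible I) (h : IsMastOf I p U) :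
    ∃ x : U, IsAdapted I p x := by
  have _ := h.1.1
  obtain ⟨a', b', p', x, hx⟩ := exists_isAdapted_of_chain (K := K) hadm h.1.2.2
  exact ⟨x, h.isAdapted hadm hx.isTopElement⟩

theorem IsAdapted.isSimpleModule_layer (h : IsAdapted I p x) {n : ℕ} (hn : n ≤ p.length) :
    IsSimpleModule (BoundAlgebra I) (Layer I U n) :=
  (covBy_iff_quot_is_simple (rad_antitone n.le_succ)).1 (h.rad_covBy hn)

omit [IsScalarTower K (BoundAlgebra I) U] in
theorem IsAdapted.hasCompositionSeries (h : IsAdapted I p x)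
    {S : Fin (p.length + 1) → ModuleCat.{max u v w} (BoundAlgebra I)}
    (hS : ∀ i : Fin (p.length + 1), Nonempty (Layer I U i ≃ₗ[BoundAlgebra I] S i)) :
    HasCompositionSeries (BoundAlgebra I) (ModuleCat.of _ U) S :=
  ⟨fun i => rad I U i, rad_zero, h.rad_eq_bot, fun i => ⟨rad_antitone (Nat.le_succ _), hS i⟩⟩

/-- A chain of submodules leaves no choice: both filtrations start at the top and descend by
covering steps, so they coincide. -/
theorem IsAdapted.layer_of_hasCompositionSeries (h : IsAdapted I p x) {l : ℕ}
    {S : Fin (l + 1) → ModuleCat.{max u v w} (BoundAlgebra I)}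
    (hS : ∀ i, IsSimpleModule (BoundAlgebra I) (S i))
    (hU : HasCompositionSeries (BoundAlgebra I) (ModuleCat.of _ U) S) :
    p.length = l ∧ ∀ i : Fin (l + 1), Nonempty (Layer I U i ≃ₗ[BoundAlgebra I] S i) := by
  obtain ⟨F, h0, hl, hF⟩ := hU
  have hcov : ∀ i : Fin (l + 1), F i.succ ⋖ F i.castSucc := fun i => by
    obtain ⟨hle, ⟨φ⟩⟩ := hF i
    have := hS i
    exact (covBy_iff_quot_is_simple hle).2 (IsSimpleModule.congr φ)
  have hle : ∀ i : ℕ, rad I U i ≠ ⊥ → i ≤ p.length := fun i hi => by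
    by_contra! hlt
    refine hi (eq_bot_iff.2 ?_)
    rw [← h.rad_eq_bot]
    exact rad_antitone hlt
  have hrad : ∀ i : Fin (l + 2), F i = rad I U i := by
    intro i
    induction i using Fin.induction with
    | zero => exact h0.trans rad_zero.symm
    | succ i ih =>
      have h1 := hcov i
      rw [ih] at h1
      have h2 := h.rad_covBy (hle i (ne_bot_of_gt h1.lt))
      obtain h3 | h3 := h.isUniserial.2.2 (F i.succ) (rad I U (i + 1))
      · exact h3.eq_of_not_lt fun h4 => h1.2 h4 h2.lt
      · exact (h3.eq_of_not_lt fun h4 => h2.2 h4 h1.lt).symm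
  have hpl : p.length = l := by
    refine le_antisymm ?_ (hle l fun h1 => ?_)
    · by_contra! hlt
      have h1 := pathClass_smul_mem_rad (I := I) p x (n := l + 1) hlt
      have h2 := hrad (Fin.last (l + 1))
      rw [hl] at h2
      change ⊥ = rad I U (l + 1) at h2
      rw [← h2] at h1
      exact h.ne_zero h1
    · have h2 := hcov (Fin.last l)
      rw [hrad (Fin.last l).castSucc] at h2
      change _ ⋖ rad I U l at h2
      rw [h1] at h2
      exact not_lt_bot h2.lt
  refine ⟨hpl, fun i => ?_⟩
  have h1 := (hF i).2
  rw [hrad i.succ, hrad i.castSucc] at h1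
  exact h1

theorem IsStandard.nil_smul {M : Type*} [AddCommGroup M] [Module (BoundAlgebra I) M]
    [Module K M] [IsScalarTower K (BoundAlgebra I) M] {c : V} {g : M}
    (h : IsStandard I (Path.nil : Path c c) g) (s : M) :
    pathClass I (Path.nil : Path c c) • s = s := by
  obtain ⟨r, rfl⟩ := Submodule.mem_span_singleton.1
    (show s ∈ Submodule.span (BoundAlgebra I) {g} by rw [h.span_eq]; trivial)
  let W : Submodule K M :=
    { carrier := {s | pathClass I (Path.nil : Path c c) • s = s}
      zero_mem' := by simp
      add_mem' := fun {s t} hs ht => by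
        simp only [Set.mem_ofPred_eq] at *
        rw [smul_add, hs, ht]
      smul_mem' := fun k s hs => by
        simp only [Set.mem_ofPred_eq] at *
        rw [pathClass_smul_comm, hs] }
  refine smul_mem_of_forall_path W g (fun d e q => ?_) r
  by_cases hd : d = c
  swap
  · rw [pathClass_smul_of_ne h.unit _ hd]
    exact W.zero_mem
  subst hd
  by_cases hq : IsRightSubpath q (Path.nil : Path d d)
  · have h0 : q.length = 0 := Nat.le_zero.1 hq.length_le
    obtain rfl := Path.eq_of_length_zero q h0
    rw [Path.eq_nil_of_length_zero q h0, h.unit]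
    exact h.unit
  · rw [h.kill _ _ hq]
    exact W.zero_mem

/-- The vertices of a mast can be read off the layers. -/
theorem IsAdapted.vertex_eq {U' : Type (max u v w)} [AddCommGroup U'] [Module (BoundAlgebra I) U']
    [Module K U'] [IsScalarTower K (BoundAlgebra I) U'] {a' b' c c' : V} {p' : Path a' b'} {x' : U'}
    (h : IsAdapted I p x) (h' : IsAdapted I p' x') {v : Path a c} {v' : Path a' c'}
    (hv : IsRightSubpath v p) (hv' : IsRightSubpath v' p')
    (φ : Layer I U v.length ≃ₗ[BoundAlgebra I] Layer I U' v'.length) : c = c' := by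
  by_contra hne
  obtain ⟨g, hs⟩ : ∃ g : Layer I U v.length, IsStandard I (Path.nil : Path c c) g :=
    ⟨_, h.isStandard_layer hv⟩
  have hs' := h'.isStandard_layer hv'
  have h1 := hs'.nil_smul (φ g)
  rw [← map_smul] at h1
  have h2 := φ.injective h1
  rw [pathClass_smul_of_ne hs.unit _ (Ne.symm hne)] at h2
  exact hs.ne_zero (by rw [← h2, smul_zero])

/-- The layers determine the vertices, and without parallel arrows the vertices determine the path.
-/
theorem IsAdapted.eq_mast {U' : Type (max u v w)} [AddCommGroup U'] [Module (BoundAlgebra I) U']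
    [Module K U'] [IsScalarTower K (BoundAlgebra I) U'] {a' b' : V} {p' : Path a' b'} {x' : U'}
    (hpar : ∀ ⦃c d : V⦄ (β β' : c ⟶ d), β = β')
    (h : IsAdapted I p x) (h' : IsAdapted I p' x') (hl : p.length = p'.length)
    (hφ : ∀ n ≤ p.length, Nonempty (Layer I U n ≃ₗ[BoundAlgebra I] Layer I U' n)) :
    (⟨a, b, p⟩ : AnyPath V) = ⟨a', b', p'⟩ := by
  suffices hall : ∀ n, ∀ (c c' : V) (v : Path a c) (v' : Path a' c'), IsRightSubpath v p →
      IsRightSubpath v' p' → v.length = n → v'.length = n →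
      (⟨a, c, v⟩ : AnyPath V) = ⟨a', c', v'⟩ from
    hall _ _ _ p p' (isRightSubpath_refl p) (isRightSubpath_refl p') hl rfl
  intro n
  induction n with
  | zero =>
    intro c c' v v' hv hv' hvl hvl'
    obtain rfl := Path.eq_of_length_zero v hvl
    obtain rfl := Path.eq_of_length_zero v' hvl'
    obtain rfl := Path.eq_nil_of_length_zero v hvl
    obtain rfl := Path.eq_nil_of_length_zero v' hvl'
    obtain ⟨φ⟩ := hφ 0 (Nat.zero_le _)
    obtain rfl := h.vertex_eq h' hv hv' φ
    rfl
  | succ n ih =>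
    intro c c' v v' hv hv' hvl hvl'
    obtain ⟨φ⟩ := hφ (n + 1) (by rw [← hvl]; exact hv.length_le)
    obtain rfl : c = c' := by
      refine h.vertex_eq h' hv hv' ?_
      rw [hvl, hvl']
      exact φ
    cases v with
    | nil => simp at hvl
    | cons v β =>
      cases v' with
      | nil => simp at hvl'
      | cons v' β' =>
        rw [Path.length_cons] at hvl hvl'
        have h1 := ih _ _ v v' (IsRightSubpath.trans ⟨β.toPath, by simp⟩ hv)
          (IsRightSubpath.trans ⟨β'.toPath, by simp⟩ hv') (by omega) (by omega)
        cases h1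
        rw [hpar β β']

theorem SufCondition.atMostOneUniserialPerSeries (hadm : IsAdmissible I) (hsuf : SufCondition I) :
    AtMostOneUniserialPerSeries (BoundAlgebra I) := by
  intro l S hS M N hM hN hMS hNS
  have hpar : ∀ ⦃c d : V⦄ (β β' : c ⟶ d), β = β' := fun _ _ =>
    (hsuf.pathConditionN hadm).arrow_eq hadm
  let _ := moduleOfBoundAlgebra I M
  let _ := moduleOfBoundAlgebra I N
  have _ := isScalarTower_moduleOfBoundAlgebra (I := I) M
  have _ := isScalarTower_moduleOfBoundAlgebra (I := I) N
  have _ := hM.1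
  have _ := hN.1
  obtain ⟨a, b, p, x, hx⟩ := exists_isAdapted_of_chain (K := K) hadm hM.2.2
  obtain ⟨a', b', p', x', hx'⟩ := exists_isAdapted_of_chain (K := K) hadm hN.2.2
  obtain ⟨hl, hφ⟩ := hx.layer_of_hasCompositionSeries hS hMS
  obtain ⟨hl', hφ'⟩ := hx'.layer_of_hasCompositionSeries hS hNS
  have heq := hx.eq_mast hpar hx' (hl.trans hl'.symm) fun n hn => by
    obtain ⟨φ⟩ := hφ ⟨n, by omega⟩
    obtain ⟨φ'⟩ := hφ' ⟨n, by omega⟩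
    exact ⟨φ.trans φ'.symm⟩
  cases heq
  obtain ⟨y, hy⟩ := hsuf.exists_isStandard hadm hx
  obtain ⟨y', hy'⟩ := hsuf.exists_isStandard hadm hx'
  exact hy.nonempty_linearEquiv hy'

theorem finite_paths_of_length [∀ a b : V, Finite (a ⟶ b)] (n : ℕ) :
    Finite {p : AnyPath V // p.2.2.length = n} := by
  induction n with
  | zero =>
    refine Finite.of_surjective (α := V)
      (fun a => (⟨⟨a, a, Path.nil⟩, rfl⟩ : {p : AnyPath V // p.2.2.length = 0})) ?_
    rintro ⟨⟨a, b, p⟩, hp⟩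
    obtain rfl := Path.eq_of_length_zero p hp
    obtain rfl := Path.eq_nil_of_length_zero p hp
    exact ⟨_, rfl⟩
  | succ n ih =>
    refine Finite.of_surjective
      (α := Σ p : {p : AnyPath V // p.2.2.length = n}, Σ c : V, (p.1.2.1 ⟶ c))
      (fun t => (⟨⟨t.1.1.1, t.2.1, t.1.1.2.2.cons t.2.2⟩, by
        rw [Path.length_cons, t.1.2]⟩ : {p : AnyPath V // p.2.2.length = n + 1})) ?_
    rintro ⟨⟨a, b, p⟩, hp⟩
    cases p with
    | nil => simp at hp
    | cons p e =>
      rw [Path.length_cons, add_left_inj] at hp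
      exact ⟨⟨⟨⟨_, _, p⟩, hp⟩, _, e⟩, rfl⟩

theorem finite_nonzeroPaths [∀ a b : V, Finite (a ⟶ b)] (hadm : IsAdmissible I) :
    {p : AnyPath V | NonzeroPath I p.2.2}.Finite := by
  obtain ⟨N, hN⟩ := hadm.1
  refine Set.Finite.subset (s := ⋃ n : Fin N, {p : AnyPath V | p.2.2.length = n})
    (Set.finite_iUnion fun n => finite_paths_of_length (V := V) n) fun p hp => ?_
  rw [Set.mem_iUnion]
  refine ⟨⟨p.2.2.length, ?_⟩, rfl⟩
  by_contra! hle
  exact hp (hN _ _ _ hle)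

/-- One module is chosen for each of the finitely many masts. A module with the same mast has the
same layers, since each layer is the simple module at the corresponding vertex. -/
theorem finiteUniserialType_of_atMostOne [∀ a b : V, Finite (a ⟶ b)] (hadm : IsAdmissible I)
    (h : AtMostOneUniserialPerSeries (BoundAlgebra I)) :
    FiniteUniserialType (BoundAlgebra I) := by
  let T := {p : AnyPath V // IsMast I p.2.2}
  have : Finite T := ((finite_nonzeroPaths hadm).subset fun _ hp => IsMast.nonzeroPath hp :
    {p : AnyPath V | IsMast I p.2.2}.Finite)
  obtain ⟨n, ⟨e⟩⟩ := Finite.exists_equiv_fin T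
  have hmast : ∀ t : T, ∃ U : ModuleCat.{max u v w} (BoundAlgebra I), IsMastOf I t.1.2.2 U :=
    fun t => t.2
  choose W hW using hmast
  refine ⟨n, fun i => W (e.symm i), fun M hM => ?_⟩
  let _ := moduleOfBoundAlgebra I M
  have _ := isScalarTower_moduleOfBoundAlgebra (I := I) M
  have _ := hM.1
  obtain ⟨a, b, p, x, hx⟩ := exists_isAdapted_of_chain (K := K) hadm hM.2.2
  let t : T := ⟨⟨a, b, p⟩, M, hx.isMastOf⟩
  refine ⟨e t, ?_⟩
  change Nonempty (M ≃ₗ[BoundAlgebra I] W (e.symm (e t)))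
  rw [e.symm_apply_apply]
  have hN : IsMastOf I p (W t) := hW t
  generalize W t = N at hN
  let _ := moduleOfBoundAlgebra I N
  have _ := isScalarTower_moduleOfBoundAlgebra (I := I) N
  obtain ⟨y, hy⟩ := hN.exists_isAdapted hadm
  refine h p.length (fun i => ModuleCat.of _ (Layer I N i)) (fun i => ?_) M N hM hN.1
    (hx.hasCompositionSeries fun i => ?_)
    (hy.hasCompositionSeries fun i => ⟨LinearEquiv.refl _ _⟩)
  · exact hy.isSimpleModule_layer (Nat.lt_succ_iff.1 i.2)
  · obtain ⟨c, v, hv, hvl⟩ := exists_isRightSubpath_length p (Nat.lt_succ_iff.1 i.2)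
    rw [← hvl]
    exact (hx.isStandard_layer hv).nonempty_linearEquiv (hy.isStandard_layer hv)

end Types

/-! ### The opposite algebra -/

section OppositePaths

variable {V : Type v} [Quiver.{w} V]

/-- A path, read backwards as a path of the opposite quiver. -/
def opPath {a : V} : {b : V} → Path a b → Path (Opposite.op b) (Opposite.op a)
  | _, Path.nil => Path.nil
  | _, Path.cons p e => e.op.toPath.comp (opPath p)

theorem opPath_comp {a b c : V} (p : Path a b) (q : Path b c) :
    opPath (p.comp q) = (opPath q).comp (opPath p) := by
  induction q with
  | nil => simp [opPath]
  | cons q e ih => simp [opPath, ih]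

theorem unopPath_opPath {a b : V} (p : Path a b) : unopPath (opPath p) = p := by
  induction p with
  | nil => rfl
  | cons p e ih =>
    rw [opPath, unopPath_comp, ih]
    rfl

theorem opPath_unopPath {a b : Vᵒᵖ} (p : Path a b) : opPath (unopPath p) = p := by
  induction p with
  | nil => rfl
  | cons p e ih =>
    rw [unopPath, opPath_comp, ih]
    rfl

theorem length_unopPath {a b : Vᵒᵖ} (p : Path a b) : (unopPath p).length = p.length := by
  induction p with
  | nil => rfl
  | cons p e ih => rw [unopPath, Path.length_comp, Path.length_cons, ih, Path.length_toPath,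
      add_comm]

theorem length_opPath {a b : V} (p : Path a b) : (opPath p).length = p.length := by
  rw [← length_unopPath, unopPath_opPath]

theorem unopPath_injective {a b : Vᵒᵖ} {p q : Path a b} (h : unopPath p = unopPath q) : p = q := by
  rw [← opPath_unopPath p, h, opPath_unopPath]

/-- Reading paths backwards, on paths with arbitrary end points. -/
def unopAnyPath (p : AnyPath Vᵒᵖ) : AnyPath V := ⟨p.2.1.unop, p.1.unop, unopPath p.2.2⟩

theorem unopAnyPath_injective : Function.Injective (unopAnyPath (V := V)) := by
  refine Function.LeftInverse.injective
    (g := fun p : AnyPath V => ⟨Opposite.op p.2.1, Opposite.op p.1, opPath p.2.2⟩) ?_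
  rintro ⟨a, b, p⟩
  simp only [unopAnyPath, opPath_unopPath]

end OppositePaths

/-! ### The opposite ideal and the symmetry of the suffix condition -/

section OppositeIdeal

variable {K : Type u} {V : Type v} [Field K] [Quiver.{w} V] [Finite V]
  {I : TwoSidedIdeal (PathAlgebra K V)}

theorem nonzeroPath_oppositeIdeal {a b : Vᵒᵖ} {p : Path a b} :
    NonzeroPath (oppositeIdeal I) p ↔ NonzeroPath I (unopPath p) := by
  rw [NonzeroPath, mem_oppositeIdeal, revLin_ofPath, NonzeroPath]

theorem nonzeroPath_opPath {a b : V} {p : Path a b} :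
    NonzeroPath (oppositeIdeal I) (opPath p) ↔ NonzeroPath I p := by
  rw [nonzeroPath_oppositeIdeal, unopPath_opPath]

omit [Finite V] in
theorem coeff_revLin (x : PathAlgebra K Vᵒᵖ) (p : AnyPath Vᵒᵖ) :
    (revLin x).coeff (unopAnyPath p) = x.coeff p := by
  have key : (PathAlgebra.pathBasis.coord (unopAnyPath p)).comp
      (revLin : PathAlgebra K Vᵒᵖ →ₗ[K] PathAlgebra K V) = PathAlgebra.pathBasis.coord p := by
    refine PathAlgebra.hom_ext fun q => ?_
    change (revLin (PathAlgebra.ofPath q.2.2)).coeff (unopAnyPath p) =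
      (PathAlgebra.single q).coeff p
    rw [revLin_ofPath]
    change (PathAlgebra.single (unopAnyPath q)).coeff (unopAnyPath p) = _
    by_cases h : q = p
    · rw [h, coeff_single_self, coeff_single_self]
    · rw [coeff_single_of_ne h, coeff_single_of_ne fun h' => h (unopAnyPath_injective h')]
  exact congrArg (fun f => f x) key

theorem IsAdmissible.oppositeIdeal (h : IsAdmissible I) : IsAdmissible (oppositeIdeal I) := by
  refine ⟨?_, fun x hx p hp => ?_⟩
  · obtain ⟨N, hN⟩ := h.1
    refine ⟨N, fun a b p hp => ?_⟩
    rw [mem_oppositeIdeal, revLin_ofPath]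
    exact hN _ _ _ (by rwa [length_unopPath])
  · rw [← length_unopPath]
    refine h.2 _ (mem_oppositeIdeal.1 hx) (unopAnyPath p) ?_
    rwa [coeff_revLin]

theorem IsMonomial.oppositeIdeal (h : IsMonomial I) : IsMonomial (oppositeIdeal I) := by
  -- Every path in the support of an element of the opposite ideal lies in that ideal when read
  -- backwards, since coefficients at nonzero paths vanish on `I`.
  refine ⟨{p | PathAlgebra.single (unopAnyPath p) ∈ I}, le_antisymm (fun x hx => ?_) ?_⟩
  · rw [← PathAlgebra.pathBasis.linearCombination_repr x, Finsupp.linearCombination_apply,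
      Finsupp.sum]
    refine sum_mem fun p hp => ?_
    rw [Algebra.smul_def]
    refine TwoSidedIdeal.mul_mem_left _ _ _ (TwoSidedIdeal.subset_span ⟨p, ?_, rfl⟩)
    by_contra hpI
    refine Finsupp.mem_support_iff.1 hp ?_
    change x.coeff p = 0
    rw [← coeff_revLin]
    exact h.coeff_eq_zero (mem_oppositeIdeal.1 hx) hpI
  · rw [TwoSidedIdeal.span_le]
    rintro _ ⟨p, hp, rfl⟩
    rw [SetLike.mem_coe, mem_oppositeIdeal]
    change revLin (PathAlgebra.ofPath p.2.2) ∈ I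
    rw [revLin_ofPath]
    exact hp

theorem CosufCondition.sufCondition_oppositeIdeal (h : CosufCondition I) :
    SufCondition (oppositeIdeal I) := by
  rintro a b c p u α ⟨r, rfl⟩ hl hα hp hu
  rw [nonzeroPath_oppositeIdeal] at hp hu
  obtain ⟨w, hw⟩ := h (unopPath (u.comp r)) (unopPath u) α.unop
    ⟨unopPath r, unopPath_comp _ _⟩ (by rwa [length_unopPath, length_unopPath])
    (fun ⟨t, ht⟩ => hα ⟨opPath t, unopPath_injective (by
      rw [ht, unopPath_comp, unopPath_opPath]; rfl)⟩) hp hu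
  refine ⟨opPath w, unopPath_injective ?_⟩
  rw [hw, unopPath, unopPath_comp, unopPath_opPath, Path.comp_assoc]

theorem CosufCondition.sufCondition_of_oppositeIdeal (h : CosufCondition (oppositeIdeal I)) :
    SufCondition I := by
  rintro a b c p u α ⟨r, rfl⟩ hl hα hp hu
  rw [← nonzeroPath_opPath] at hp hu
  obtain ⟨w, hw⟩ := h (opPath (u.comp r)) (opPath u) α.op
    ⟨opPath r, opPath_comp _ _⟩ (by rwa [length_opPath, length_opPath])
    (fun ⟨t, ht⟩ => hα ⟨unopPath t, by
      have := congrArg unopPath ht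
      rw [unopPath_opPath, unopPath_comp] at this
      rw [this]
      congr 1
      exact unopPath_opPath (u.cons α)⟩) hp hu
  refine ⟨unopPath w, ?_⟩
  have := congrArg unopPath hw
  rw [unopPath_opPath, unopPath_comp] at this
  rw [this, ← Path.comp_cons]
  congr 1
  exact unopPath_opPath (u.cons α)

/-- Reversal exchanges `SufCondition` and `CosufCondition`, and the first implies the second for
both ideals. -/
theorem sufCondition_oppositeIdeal_iff (hadm : IsAdmissible I) :
    SufCondition (oppositeIdeal I) ↔ SufCondition I :=
  ⟨fun h => (h.cosufCondition hadm.oppositeIdeal).sufCondition_of_oppositeIdeal,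
    fun h => (h.cosufCondition hadm).sufCondition_oppositeIdeal⟩

theorem revLin_surjective :
    Function.Surjective (revLin : PathAlgebra K Vᵒᵖ → PathAlgebra K V) := by
  rw [← LinearMap.range_eq_top, eq_top_iff, ← span_single K V, Submodule.span_le]
  rintro _ ⟨⟨a, b, p⟩, rfl⟩
  refine ⟨PathAlgebra.ofPath (opPath p), ?_⟩
  rw [revLin_ofPath, unopPath_opPath]
  rfl

variable (I) in
/-- The algebra of the opposite quiver and ideal is the opposite algebra. -/
def boundAlgebraOppositeEquiv : BoundAlgebra (oppositeIdeal I) ≃+* (BoundAlgebra I)ᵐᵒᵖ :=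
  let g : PathAlgebra K Vᵒᵖ →+* (BoundAlgebra I)ᵐᵒᵖ := (RingHom.op I.ringCon.mk').comp opHom
  have hg : ∀ x, g x = MulOpposite.op (I.ringCon.mk' (revLin x)) := fun _ => rfl
  have hker : ∀ x y, (oppositeIdeal I).ringCon x y ↔ g x = g y := fun x y => by
    rw [TwoSidedIdeal.rel_iff, mem_oppositeIdeal, hg, hg, MulOpposite.op_inj, ← sub_eq_zero,
      ← map_sub, mk_eq_zero, map_sub]
  RingEquiv.ofBijective ((oppositeIdeal I).ringCon.lift g fun x y h => (hker x y).1 h) (by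
    constructor
    · intro r s h
      obtain ⟨x, rfl⟩ := mk_surjective _ r
      obtain ⟨y, rfl⟩ := mk_surjective _ s
      exact (RingCon.eq _).2 ((hker x y).2 h)
    · intro r
      obtain ⟨y, hy⟩ := mk_surjective I r.unop
      obtain ⟨x, rfl⟩ := revLin_surjective y
      exact ⟨(oppositeIdeal I).ringCon.mk' x, (hg x).trans (by rw [hy, MulOpposite.op_unop])⟩)

end OppositeIdeal

/-! ### Invariance under ring isomorphisms -/

section Transport

variable {R S : Type u} [Ring R] [Ring S] (e : R ≃+* S)

/-- A module over `S`, as a module over the isomorphic ring `R`. -/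
abbrev pullModule (M : ModuleCat.{u} S) : ModuleCat.{u} R :=
  (ModuleCat.restrictScalars (e : R →+* S)).obj M

theorem pullModule_smul (M : ModuleCat.{u} S) (r : R) (x : M) :
    (r • (show pullModule e M from x) : pullModule e M) = e r • x := rfl

/-- A submodule over `S`, as a submodule over `R`. -/
def pullSubmodule {M : ModuleCat.{u} S} (N : Submodule S M) : Submodule R (pullModule e M) where
  carrier := (N : Set M)
  zero_mem' := N.zero_mem
  add_mem' := N.add_mem
  smul_mem' r _ hx := N.smul_mem (e r) hx

/-- A submodule over `R`, as a submodule over `S`. -/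
def pushSubmodule {M : ModuleCat.{u} S} (N : Submodule R (pullModule e M)) : Submodule S M where
  carrier := (N : Set (pullModule e M))
  zero_mem' := N.zero_mem
  add_mem' := N.add_mem
  smul_mem' s x hx := by
    have h : e.symm s • (show pullModule e M from x) ∈ N := N.smul_mem (e.symm s) hx
    rwa [pullModule_smul, e.apply_symm_apply] at h

theorem isUniserial_pullModule {M : ModuleCat.{u} S} (h : IsUniserial S M) :
    IsUniserial R (pullModule e M) := by
  obtain ⟨hn, ⟨⟨T, hT⟩⟩, hc⟩ := h
  refine ⟨hn, ⟨⟨show Finset (pullModule e M) from T, ?_⟩⟩, fun N N' =>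
    hc (pushSubmodule e N) (pushSubmodule e N')⟩
  rw [eq_top_iff]
  have h1 : Submodule.span S (T : Set M) ≤
      pushSubmodule e (Submodule.span R (show Set (pullModule e M) from (T : Set M))) :=
    Submodule.span_le.2 fun x hx => Submodule.subset_span (R := R) (M := pullModule e M) hx
  rw [hT] at h1
  exact fun x _ => h1 (show x ∈ (⊤ : Submodule S M) from trivial)

theorem nonempty_linearEquiv_of_pullModule {M N : ModuleCat.{u} S}
    (h : Nonempty (pullModule e M ≃ₗ[R] pullModule e N)) : Nonempty (M ≃ₗ[S] N) := by
  obtain ⟨φ⟩ := h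
  refine ⟨{ φ.toAddEquiv with map_smul' := fun s x => ?_ }⟩
  have := φ.map_smul (e.symm s) x
  change φ (e (e.symm s) • (show M from x)) = e (e.symm s) • (show N from φ x) at this
  rw [e.apply_symm_apply] at this
  exact this

theorem FiniteUniserialType.of_ringEquiv (e : R ≃+* S) (h : FiniteUniserialType R) :
    FiniteUniserialType S := by
  obtain ⟨n, U, hU⟩ := h
  refine ⟨n, fun i => pullModule e.symm (U i), fun M hM => ?_⟩
  obtain ⟨i, ⟨φ⟩⟩ := hU (pullModule e M) (isUniserial_pullModule e hM)
  refine ⟨i, ⟨{ φ.toAddEquiv with map_smul' := fun s x => ?_ }⟩⟩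
  have := φ.map_smul (e.symm s) x
  change φ (e (e.symm s) • (show M from x)) = _ at this
  rw [e.apply_symm_apply] at this
  exact this

theorem isSimpleModule_pullModule {M : ModuleCat.{u} S} (h : IsSimpleModule S M) :
    IsSimpleModule R (pullModule e M) := by
  rw [isSimpleModule_iff_toSpanSingleton_surjective] at h ⊢
  refine ⟨h.1, fun x hx y => ?_⟩
  obtain ⟨s, hs⟩ := h.2 x hx y
  refine ⟨e.symm s, ?_⟩
  change e (e.symm s) • (show M from x) = y
  rw [e.apply_symm_apply]
  exact hs

theorem hasCompositionSeries_pullModule {M : ModuleCat.{u} S} {l : ℕ}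
    {T : Fin (l + 1) → ModuleCat.{u} S} (h : HasCompositionSeries S M T) :
    HasCompositionSeries R (pullModule e M) fun i => pullModule e (T i) := by
  obtain ⟨F, h0, hl, hF⟩ := h
  refine ⟨fun i => pullSubmodule e (F i), ?_, ?_, fun i => ⟨(hF i).1, ?_⟩⟩
  · exact SetLike.coe_injective (congrArg (fun N : Submodule S M => (N : Set M)) h0)
  · exact SetLike.coe_injective (congrArg (fun N : Submodule S M => (N : Set M)) hl)
  · obtain ⟨φ⟩ := (hF i).2
    -- The factor is rebuilt over `R` as the quotient by the kernel of the surjection onto `S(i)`.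
    let ψ := φ.toLinearMap.comp (Submodule.mkQ ((F i.succ).submoduleOf (F i.castSucc)))
    have hψ : Function.Surjective ψ := φ.surjective.comp (Submodule.mkQ_surjective _)
    have hker : ∀ x, ψ x = 0 ↔ (x : M) ∈ F i.succ := fun x => by
      change φ (Submodule.Quotient.mk x) = 0 ↔ _
      rw [φ.map_eq_zero_iff, Submodule.Quotient.mk_eq_zero, Submodule.submoduleOf,
        Submodule.mem_comap]
      rfl
    let χ : pullSubmodule e (F i.castSucc) →ₗ[R] pullModule e (T i) :=
      { toFun := fun x => ψ ⟨x.1, x.2⟩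
        map_add' := fun x y => ψ.map_add ⟨x.1, x.2⟩ ⟨y.1, y.2⟩
        map_smul' := fun r x => ψ.map_smul (e r) ⟨x.1, x.2⟩ }
    have hχ : Function.Surjective χ := fun y => by
      obtain ⟨x, hx⟩ := hψ y
      exact ⟨⟨x.1, x.2⟩, hx⟩
    refine ⟨(Submodule.quotEquivOfEq _ _ ?_).trans (χ.quotKerEquivOfSurjective hχ)⟩
    ext x
    rw [LinearMap.mem_ker, Submodule.submoduleOf,
      Submodule.mem_comap]
    exact (hker ⟨x.1, x.2⟩).symm

theorem AtMostOneUniserialPerSeries.of_ringEquiv (e : R ≃+* S) (h : AtMostOneUniserialPerSeries R) :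
    AtMostOneUniserialPerSeries S := fun l T hT _ _ hM hN hMT hNT =>
  nonempty_linearEquiv_of_pullModule e (h l (fun i => pullModule e (T i))
    (fun i => isSimpleModule_pullModule e (hT i)) _ _ (isUniserial_pullModule e hM)
    (isUniserial_pullModule e hN) (hasCompositionSeries_pullModule e hMT)
    (hasCompositionSeries_pullModule e hNT))

end Transport

/-! ### The equivalences with the suffix condition -/

section Equivalences

variable {K : Type u} {V : Type v} [Field K] [Infinite K] [Quiver.{w} V] [Finite V]
  {I : TwoSidedIdeal (PathAlgebra K V)}

theorem atMostOneUniserialPerSeries_iff [∀ a b : V, Finite (a ⟶ b)] (hadm : IsAdmissible I)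
    (hmon : IsMonomial I) : AtMostOneUniserialPerSeries (BoundAlgebra I) ↔ SufCondition I :=
  ⟨fun h => sufCondition_of_finiteUniserialType hmon (finiteUniserialType_of_atMostOne hadm h),
    fun h => h.atMostOneUniserialPerSeries hadm⟩

theorem finiteUniserialType_iff [∀ a b : V, Finite (a ⟶ b)] (hadm : IsAdmissible I)
    (hmon : IsMonomial I) : FiniteUniserialType (BoundAlgebra I) ↔ SufCondition I :=
  ⟨sufCondition_of_finiteUniserialType hmon,
    fun h => finiteUniserialType_of_atMostOne hadm (h.atMostOneUniserialPerSeries hadm)⟩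

theorem allMastsSuf_iff (hadm : IsAdmissible I) (hmon : IsMonomial I) :
    AllMastsSuf I ↔ SufCondition I :=
  ⟨sufCondition_of_allMastsSuf hmon, fun h => h.allMastsSuf hadm⟩

omit [Infinite K] in
theorem conditionN_and_repeatedSegments_iff (hadm : IsAdmissible I) (hmon : IsMonomial I) :
    ConditionN I ∧ RepeatedSegments I ↔ SufCondition I :=
  ⟨fun h => sufCondition_of_repeatedSegments hadm (h.1.pathConditionN hadm hmon) h.2,
    fun h => ⟨h.conditionN hadm, h.repeatedSegments hadm⟩⟩

end Equivalences

end UniserialType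

end

/-! ### The equivalence theorem -/

open UniserialType in
theorem theorem6p3 {K : Type u} {V : Type v} [Field K] [Infinite K] [Quiver.{w} V] [Finite V]
    [∀ a b : V, Finite (a ⟶ b)] (I : TwoSidedIdeal (PathAlgebra K V))
    (hadm : IsAdmissible I) (hmon : IsMonomial I) :
    List.TFAE
      [FiniteUniserialType (BoundAlgebra I),
       AtMostOneUniserialPerSeries (BoundAlgebra I),
       AllMastsSuf I,
       ConditionN I ∧ RepeatedSegments I,
       FiniteUniserialType (BoundAlgebra I)ᵐᵒᵖ,
       AtMostOneUniserialPerSeries (BoundAlgebra I)ᵐᵒᵖ,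
       AllMastsSuf (oppositeIdeal I),
       ConditionN (oppositeIdeal I) ∧ RepeatedSegments (oppositeIdeal I)] := by
  have hfin : ∀ a b : Vᵒᵖ, Finite (a ⟶ b) := fun a b =>
    Finite.of_injective (fun f : a ⟶ b => f.unop) Quiver.Hom.unop_inj
  have hadm' := hadm.oppositeIdeal
  have hmon' := hmon.oppositeIdeal
  have hop := sufCondition_oppositeIdeal_iff hadm
  have e := boundAlgebraOppositeEquiv I
  have h1 : FiniteUniserialType (BoundAlgebra I)ᵐᵒᵖ ↔ SufCondition I :=
    ⟨fun h => hop.1 ((finiteUniserialType_iff hadm' hmon').1 (.of_ringEquiv e.symm h)),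
      fun h => FiniteUniserialType.of_ringEquiv e ((finiteUniserialType_iff hadm' hmon').2 (hop.2 h))⟩
  have h2 : AtMostOneUniserialPerSeries (BoundAlgebra I)ᵐᵒᵖ ↔ SufCondition I :=
    ⟨fun h => hop.1 ((atMostOneUniserialPerSeries_iff hadm' hmon').1 (.of_ringEquiv e.symm h)),
      fun h => AtMostOneUniserialPerSeries.of_ringEquiv e
        ((atMostOneUniserialPerSeries_iff hadm' hmon').2 (hop.2 h))⟩
  rw [finiteUniserialType_iff hadm hmon, atMostOneUniserialPerSeries_iff hadm hmon,
    allMastsSuf_iff hadm hmon, conditionN_and_repeatedSegments_iff hadm hmon, h1, h2,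
    allMastsSuf_iff hadm' hmon', conditionN_and_repeatedSegments_iff hadm' hmon', hop]
  -- All eight entries have become `SufCondition I`.
  intro p hp q hq
  simp only [List.mem_cons, List.not_mem_nil, or_false, or_self] at hp hq
  rw [hp, hq]
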